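/- **Setting.** Let $\Sigma$ be a finite alphabet. An *edit path* from $u\in\Sigma^*$ to $v\in\Sigma^*$ is a finite sequence $p=(a_1,b_1)\cdots(a_N,b_N)$ of pairs in $(\Sigma\cup\{\varepsilon\})^2\setminus\{(\varepsilon,\varepsilon)\}$ with $a_1\cdots a_N=u$ and $b_1\cdots b_N=v$; its length is $|p|=N$, its weight $\mathrm{wgt}(p)$ is the number of $t$ with $a_t\ne b_t$, and $\mathrm{ned}(u,v)=\min_p \mathrm{wgt}(p)/|p|$ over all edit paths from $u$ to $v$ (with $\mathrm{ned}(\varepsilon,\varepsilon)=0$). For languages $X,Y$ put $$\overrightarrow{\mathrm{AH}}_{\mathrm{ned}}(X,Y)=\lim_{K\to\infty}\ \sup_{x\in X,\ |x|\ge K}\ \inf_{y\in Y}\mathrm{ned}(x,y),$$ with the convention $\sup\emptyset=0$. Let $n,m\ge 1$, let $x_1,\dots,x_n,y_1,\dots,y_m\in\Sigma^*$, and let $X\subseteq x_1^*\cdots x_n^*$ and $Y\subseteq y_1^*\cdots y_m^*$ be bounded context-free languages whose Parikh images with respect to these words are stratified linear sets: $X=\{x_1^{\nu_1}\cdots x_n^{\nu_n}:\nu\in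 u_0+\sum_{q=1}^k\mathbb N u_q\}$ and $Y=\{y_1^{\mu_1}\cdots y_m^{\mu_m}:\mu\in v_0+\sum_{s=1}^r\mathbb N v_s\}$, with $u_q\in\mathbb N^n$, $v_s\in\mathbb N^m$. (Stratified: each of the period vectors $u_1,\dots,u_k$ has at most two non-zero coordinates, and there are no indices $i_1<j_1<i_2<j_2$ such that one period vector is non-zero at $i_1,i_2$ and another is non-zero at $j_1,j_2$; similarly for $v_1,\dots,v_r$.) *Directions.* $D_X\subseteq\mathbb R^n$ is the closure of the set of vectors $\nu/\ell(\nu)$, where $\nu$ ranges over $\sum_{q=1}^k\mathbb N u_q$ with $\ell(\nu):=\sum_i\nu_i|x_i|\neq0$. *Interleavings.* $\Pi$ is the set of the cell sets $\pi\subseteq\{1,\dots,n\}\times\{1,\dots,m\}$ of the monotone paths from $(1,1)$ to $(n,m)$ whose steps are $(i,j)\to(i+1,j)$ and $(i,j)\to(i,j+1)$. *Cyclic edit graphs.* $G_{i,j}$ is the directed multigraph obtained from the grid $\{0,\dots,|x_i|\}\times\{0,\dots,|y_j|\}$ by identifying $(0,t)$ with $(|x_i|,t)$ and $(l,0)$ with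 $(l,|y_j|)$. Its edges are the deletions $(l,t)\to(l+1,t)$ and the insertions $(l,t)\to(l,t+1)$, of weight $1$, and the diagonal edges $(l,t)\to(l+1,t+1)$, of weight $0$ if letter $l+1$ of $x_i$ equals letter $t+1$ of $y_j$ and of weight $1$ otherwise (edges of the grid that coincide after the identification are counted once). Write $c(e)$ for the weight of $e$. Let $\mathbb 1_{x}(e)=1$ if $e$ is a deletion or a diagonal edge and $0$ otherwise, and $\mathbb 1_{y}(e)=1$ if $e$ is an insertion or a diagonal edge and $0$ otherwise. *The linear program.* For $a\in D_X$ and $\pi\in\Pi$, $\mathrm{OPT}_{a,\pi}$ is the minimum of $\sum_{(i,j)\in\pi}\sum_{e\in E(G_{i,j})}f^{i,j}_e\,c(e)$ over all $f^{i,j}_e\ge0$ ($(i,j)\in\pi$, $e\in E(G_{i,j})$), $\tau_1,\dots,\tau_r\ge0$ and $\lambda\in(0,1]$ such that 1. $\sum_{(i,j)\in\pi}\sum_{e} f^{i,j}_e=1$; 2. $\sum_{e\in\mathrm{Out}(w)}f^{i,j}_e=\sum_{e\in\mathrm{In}(w)}f^{i,j}_e$ for all $(i,j)\in\pi$ and all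 vertices $w$ of $G_{i,j}$; 3. $\sum_{j:(i,j)\in\pi}\sum_{e}f^{i,j}_e\,\mathbb 1_{x}(e)=|x_i|\,a_i\,\lambda$ for all $1\le i\le n$; 4. $\sum_{i:(i,j)\in\pi}\sum_{e}f^{i,j}_e\,\mathbb 1_{y}(e)=|y_j|\sum_{s=1}^r\tau_s\,(v_s)_j$ for all $1\le j\le m$. **Theorem.** For all $a\in D_X$ and $\pi\in\Pi$ this linear program is feasible and its minimum is attained; the limit that defines $\overrightarrow{\mathrm{AH}}_{\mathrm{ned}}(X,Y)$ exists; and $$\overrightarrow{\mathrm{AH}}_{\mathrm{ned}}(X,Y)=\sup_{a\in D_X}\ \min_{\pi\in\Pi}\ \mathrm{OPT}_{a,\pi}.$$ -/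

import Mathlib

open Filter Topology

noncomputable section

namespace AHned

/-! ### The asymptotic directional distance -/

/-- The sequence `k ↦ sup_{x ∈ X, s x ≥ k} inf_{y ∈ Y} d x y`.  It is used for bounded distances
`d ≥ 0`; the supremum of the empty set is `0`, the least element of `[0, ∞)`. -/
def tailSup {M : Type*} (d : M → M → ℝ) (s : M → ℝ) (X Y : Set M) (k : ℕ) : ℝ :=
  ⨆ x : {x : M // x ∈ X ∧ (k : ℝ) ≤ s x}, ⨅ y : Y, d x.1 y.1

/-- The asymptotic directional distance `lim_{k → ∞} sup_{x ∈ X, s x ≥ k} inf_{y ∈ Y} d x y`. -/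
def asympDirDist {M : Type*} (d : M → M → ℝ) (s : M → ℝ) (X Y : Set M) : ℝ :=
  limUnder atTop (tailSup d s X Y)

/-! ### Edit paths and the normalized edit distance -/

variable {α : Type*}

/-- Edit operations `(a, b)` with `a, b ∈ Σ ∪ {ε}`, not both `ε`; `none` stands for `ε`. -/
abbrev EditOp (α : Type*) : Type _ := {p : Option α × Option α // p ≠ (none, none)}

/-- `p` is an edit path from `u` to `v`. -/
def IsEditPath (p : List (EditOp α)) (u v : List α) : Prop :=
  p.filterMap (fun e => e.1.1) = u ∧ p.filterMap (fun e => e.1.2) = v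

/-- The uniform weight of an edit operation: `0` for a no-op and `1` otherwise. -/
def opWeight [DecidableEq α] (e : EditOp α) : ℝ := if e.1.1 = e.1.2 then 0 else 1

/-- The weight of an edit path. -/
def pathWeight [DecidableEq α] (p : List (EditOp α)) : ℝ := (p.map opWeight).sum

/-- The cost of an edit path: weight divided by length (the empty path costs `0 / 0 = 0`). -/
def pathCost [DecidableEq α] (p : List (EditOp α)) : ℝ := pathWeight p / (p.length : ℝ)

/-- The normalized edit distance. -/
def ned [DecidableEq α] (u v : List α) : ℝ :=
  sInf {c : ℝ | ∃ p : List (EditOp α), IsEditPath p u v ∧ c = pathCost p}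

/-- The asymptotic directional distance from `X` to `Y` for the normalized edit distance, where
the size of a word is its length. -/
def asympNed [DecidableEq α] (X Y : Language α) : ℝ :=
  asympDirDist ned (fun w : List α => (w.length : ℝ)) X Y

/-! ### Bounded languages with stratified linear Parikh image -/

/-- The word `x₁^{v₁} ⋯ xₙ^{vₙ}`. -/
def powWord {n : ℕ} (x : Fin n → List α) (v : Fin n → ℕ) : List α :=
  (List.ofFn fun i => (List.replicate (v i) (x i)).flatten).flatten

/-- The linear set `{u₀ + t₁ u₁ + ⋯ + tₖ uₖ | t₁, …, tₖ ∈ ℕ}`. -/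
def linearSet {n k : ℕ} (u₀ : Fin n → ℕ) (U : Fin k → Fin n → ℕ) : Set (Fin n → ℕ) :=
  {v | ∃ t : Fin k → ℕ, v = u₀ + ∑ q, t q • U q}

/-- Each period vector has at most two non-zero coordinates, and the non-zero coordinates of two
period vectors do not interleave. -/
def IsStratified {n k : ℕ} (U : Fin k → Fin n → ℕ) : Prop :=
  (∀ q, (Finset.univ.filter fun i => U q i ≠ 0).card ≤ 2) ∧
  ∀ q q' : Fin k, ¬ ∃ i₁ j₁ i₂ j₂ : Fin n, i₁ < j₁ ∧ j₁ < i₂ ∧ i₂ < j₂ ∧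
    U q i₁ ≠ 0 ∧ U q i₂ ≠ 0 ∧ U q' j₁ ≠ 0 ∧ U q' j₂ ≠ 0

/-- `X ⊆ x₁^* ⋯ xₙ^*` is a bounded context-free language whose Parikh image with respect to
`x₁, …, xₙ` is the stratified linear set with constant vector `u₀` and period vectors `U`. -/
structure IsStratifiedLinearBCFL {n k : ℕ} (x : Fin n → List α) (u₀ : Fin n → ℕ)
    (U : Fin k → Fin n → ℕ) (X : Language α) : Prop where
  contextFree : X.IsContextFree
  stratified : IsStratified U
  parikh : (X : Set (List α)) = powWord x '' linearSet u₀ U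

/-! ### Directions -/

/-- The length of `x₁^{v₁} ⋯ xₙ^{vₙ}`. -/
def powLength {n : ℕ} (x : Fin n → List α) (v : Fin n → ℕ) : ℕ := ∑ i, v i * (x i).length

/-- The direction induced by a vector `v` (with `powLength x v ≠ 0`). -/
def direction {n : ℕ} (x : Fin n → List α) (v : Fin n → ℕ) : Fin n → ℝ :=
  fun i => (v i : ℝ) / (powLength x v : ℝ)

/-- The closure in `ℝⁿ` of the set of directions induced by the vectors of `S`; vectors that
stand for the empty word induce no direction. -/
def directionSet {n : ℕ} (x : Fin n → List α) (S : Set (Fin n → ℕ)) : Set (Fin n → ℝ) :=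
  closure {d | ∃ v ∈ S, powLength x v ≠ 0 ∧ d = direction x v}

/-! ### Interleavings -/

/-- One step of a monotone path in the `n × m` grid. -/
def GridStep {n m : ℕ} (c d : Fin n × Fin m) : Prop :=
  (d.1.val = c.1.val + 1 ∧ d.2 = c.2) ∨ (d.1 = c.1 ∧ d.2.val = c.2.val + 1)

/-- `π` is the set of cells of a monotone path from the first to the last cell of the
`n × m` grid. -/
def IsInterleaving {n m : ℕ} (π : Finset (Fin n × Fin m)) : Prop :=
  ∃ l : List (Fin n × Fin m), l.IsChain GridStep ∧
    (∃ c ∈ l.head?, c.1.val = 0 ∧ c.2.val = 0) ∧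
    (∃ c ∈ l.getLast?, c.1.val + 1 = n ∧ c.2.val + 1 = m) ∧
    π = l.toFinset

/-- The set of all interleavings of the `n × m` grid. -/
abbrev Interleaving (n m : ℕ) : Type := {π : Finset (Fin n × Fin m) // IsInterleaving π}

/-! ### The cyclic edit graph -/

/-- Positions `0, …, |u|` of a word with `|u|` identified with `0`, through the representatives
`0, …, |u| - 1` (and the single position `0` if `u` is empty). -/
abbrev CycPos (u : List α) : Type := Fin (max u.length 1)

/-- The class of the position `l`, for `0 ≤ l ≤ |u|`. -/
def CycPos.mk (u : List α) (l : ℕ) : CycPos u :=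
  ⟨l % max u.length 1, Nat.mod_lt _ (by omega)⟩

/-- Vertices of the cyclic edit graph of `u` and `v`. -/
abbrev CycVertex (u v : List α) : Type := CycPos u × CycPos v

/-- Edges of the cyclic edit graph of `u` and `v`: deletions `(l, k) → (l + 1, k)`, insertions
`(l, k) → (l, k + 1)`, and diagonal edges `(l, k) → (l + 1, k + 1)`. -/
inductive CycEdge (u v : List α) : Type
  | del (l : Fin u.length) (k : CycPos v)
  | ins (l : CycPos u) (k : Fin v.length)
  | diag (l : Fin u.length) (k : Fin v.length)

namespace CycEdge

variable {u v : List α}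

/-- The edges as a disjoint sum, which shows that there are finitely many. -/
def equivSum (u v : List α) :
    CycEdge u v ≃
      (Fin u.length × CycPos v) ⊕ (CycPos u × Fin v.length) ⊕ (Fin u.length × Fin v.length) where
  toFun
    | del l k => Sum.inl (l, k)
    | ins l k => Sum.inr (Sum.inl (l, k))
    | diag l k => Sum.inr (Sum.inr (l, k))
  invFun
    | Sum.inl (l, k) => del l k
    | Sum.inr (Sum.inl (l, k)) => ins l k
    | Sum.inr (Sum.inr (l, k)) => diag l k
  left_inv e := by cases e <;> rfl
  right_inv s := by rcases s with ⟨l, k⟩ | ⟨l, k⟩ | ⟨l, k⟩ <;> rfl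

instance : Fintype (CycEdge u v) := Fintype.ofEquiv _ (equivSum u v).symm

/-- Source vertex of an edge. -/
def src : CycEdge u v → CycVertex u v
  | del l k => (CycPos.mk u l, k)
  | ins l k => (l, CycPos.mk v k)
  | diag l k => (CycPos.mk u l, CycPos.mk v k)

/-- Target vertex of an edge. -/
def tgt : CycEdge u v → CycVertex u v
  | del l k => (CycPos.mk u (l + 1), k)
  | ins l k => (l, CycPos.mk v (k + 1))
  | diag l k => (CycPos.mk u (l + 1), CycPos.mk v (k + 1))

/-- The weight of an edge: `0` for a no-op and `1` for every other edge. -/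
def weight [DecidableEq α] : CycEdge u v → ℝ
  | del _ _ => 1
  | ins _ _ => 1
  | diag l k => if u.get l = v.get k then 0 else 1

/-- `1` if the edge consumes a letter of the source word, and `0` otherwise. -/
def readsSource : CycEdge u v → ℝ
  | del _ _ => 1
  | ins _ _ => 0
  | diag _ _ => 1

/-- `1` if the edge consumes a letter of the target word, and `0` otherwise. -/
def readsTarget : CycEdge u v → ℝ
  | del _ _ => 0
  | ins _ _ => 1
  | diag _ _ => 1

end CycEdge

/-! ### The linear program -/

section LP

variable {n m r : ℕ}

/-- An assignment of values to the variables `f^{i,j}_e`; only its values on the blocks of the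
interleaving under consideration play a role. -/
abbrev FlowVar (x : Fin n → List α) (y : Fin m → List α) : Type :=
  (c : Fin n × Fin m) → CycEdge (x c.1) (y c.2) → ℝ

/-- The constraints of the linear program for the direction `a` and the interleaving `π`. -/
structure LPFeasible (x : Fin n → List α) (y : Fin m → List α) (V : Fin r → Fin m → ℕ)
    (a : Fin n → ℝ) (π : Finset (Fin n × Fin m))
    (f : FlowVar x y) (τ : Fin r → ℝ) (lam : ℝ) : Prop where
  flow_nonneg : ∀ c ∈ π, ∀ e, 0 ≤ f c e
  tau_nonneg : ∀ s, 0 ≤ τ s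
  lam_mem : lam ∈ Set.Ioc (0 : ℝ) 1
  normalization : ∑ c ∈ π, ∑ e, f c e = 1
  conservation : ∀ c ∈ π, ∀ w : CycVertex (x c.1) (y c.2),
    ∑ e with CycEdge.src e = w, f c e = ∑ e with CycEdge.tgt e = w, f c e
  source : ∀ i : Fin n,
    ∑ c ∈ π with c.1 = i, ∑ e, f c e * e.readsSource = ((x i).length : ℝ) * a i * lam
  target : ∀ j : Fin m,
    ∑ c ∈ π with c.2 = j, ∑ e, f c e * e.readsTarget =
      ((y j).length : ℝ) * ∑ s, τ s * (V s j : ℝ)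

/-- The objective of the linear program. -/
def lpObjective [DecidableEq α] (x : Fin n → List α) (y : Fin m → List α)
    (π : Finset (Fin n × Fin m)) (f : FlowVar x y) : ℝ :=
  ∑ c ∈ π, ∑ e, f c e * e.weight

/-- The objective values of the feasible points. -/
def lpValues [DecidableEq α] (x : Fin n → List α) (y : Fin m → List α) (V : Fin r → Fin m → ℕ)
    (a : Fin n → ℝ) (π : Finset (Fin n × Fin m)) : Set ℝ :=
  {z | ∃ (f : FlowVar x y) (τ : Fin r → ℝ) (lam : ℝ),
    LPFeasible x y V a π f τ lam ∧ z = lpObjective x y π f}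

/-- The optimal value of the linear program. -/
def lpOpt [DecidableEq α] (x : Fin n → List α) (y : Fin m → List α) (V : Fin r → Fin m → ℕ)
    (a : Fin n → ℝ) (π : Finset (Fin n × Fin m)) : ℝ :=
  sInf (lpValues x y V a π)

end LP

end AHned

end

/-!
Both inequalities compare an edit path with a flow in the cyclic edit graphs; only the linearity of
the two Parikh images enters.

*From flows to paths.* For a word `x ^ (u₀ + ν)` of the source language take an optimal solution
for the direction of `ν` and scale it by `N = ℓ(ν) / λ`, so that its source part becomes exactly
`ν`.  In each cell the flow is a circulation, hence a combination of boundedly many short closed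
walks (`exists_walk_decomposition`).  Repeating each walk as often as its coefficient prescribes,
minus a constant number of times, gives an edit path between subwords of powers of the two block
words (`exists_cell_path`).  Because of the omitted copies the concatenation of these paths along
the interleaving uses no more copies of any block than are available, so it is completed by boundedly
many deletions and insertions to an edit path from `x ^ (u₀ + ν)` to a word of the target language
(`exists_path_of_lpFeasible`).  Its cost exceeds the optimal value by `O(1 / ℓ(ν))`.

*From paths to flows.* The letters of a product of powers are read off cyclic words, so every edit
path runs monotonically through the cells of some interleaving and performs one walk in each cell's
cyclic edit graph (`exists_cellTrace`).  Its edge counts, divided by its length, violate the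
constraints of the linear program only by `O(1 / length)` and by the distance between the direction
of the source word and the given direction (`exists_lpResidual_le`).  A compactness argument then
shows that the cost is at least the optimal value up to a small error (`exists_lpOpt_sub_le`).  The
constraint `λ > 0` is not closed, but `λ + cost ≥ 1` holds at every feasible point, so `λ` stays
away from `0` as long as the cost stays below `1`, and a point of value at most `1`, the deletion of
the whole source word, always exists.  The same compactness argument gives the attainment of the
minimum (`isLeast_lpOpt`).

The limit exists because the tail suprema are antitone and bounded below.
-/

noncomputable section

namespace AHned

/-! ### Circulations in finite directed graphs -/

section Circulation

variable {V E : Type*} {src tgt : E → V}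

/-- `IsWalk src tgt s p t`: the edges `p` form a walk from the vertex `s` to the vertex `t`. -/
def IsWalk (src tgt : E → V) : V → List E → V → Prop
  | s, [], t => s = t
  | s, e :: p, t => src e = s ∧ IsWalk src tgt (tgt e) p t

lemma IsWalk.append {p q : List E} {s t w : V} (hp : IsWalk src tgt s p t)
    (hq : IsWalk src tgt t q w) : IsWalk src tgt s (p ++ q) w := by
  induction p generalizing s with
  | nil => cases hp; exact hq
  | cons e p ih => exact ⟨hp.1, ih hp.2⟩

lemma IsWalk.replicate {p : List E} {s : V} (hp : IsWalk src tgt s p s) (k : ℕ) :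
    IsWalk src tgt s (List.replicate k p).flatten s := by
  induction k with
  | zero => exact rfl
  | succ k ih => rw [List.replicate_succ, List.flatten_cons]; exact hp.append ih

lemma IsWalk.balance [DecidableEq V] {p : List E} {s t : V} (hp : IsWalk src tgt s p t) (w : V) :
    (p.map fun e => if src e = w then (1 : ℝ) else 0).sum + (if t = w then 1 else 0) =
      (p.map fun e => if tgt e = w then (1 : ℝ) else 0).sum + (if s = w then 1 else 0) := by
  induction p generalizing s with
  | nil => cases hp; simp
  | cons e p ih =>
    have h := ih hp.2
    simp only [List.map_cons, List.sum_cons, hp.1]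
    linarith

lemma isWalk_iterate (g : E → E) (hg : ∀ e, src (g e) = tgt e) (e : E) (k : ℕ) :
    IsWalk src tgt (src e) ((List.range k).map fun i => g^[i] e) (src (g^[k] e)) := by
  induction k with
  | zero => exact rfl
  | succ k ih =>
    rw [List.range_succ, List.map_append]
    refine ih.append ⟨rfl, ?_⟩
    rw [Function.iterate_succ_apply', hg]
    exact rfl

lemma isWalk_map {E' : Type*} (φ : E' → E) {s t : V} {p : List E'}
    (h : IsWalk (src ∘ φ) (tgt ∘ φ) s p t) : IsWalk src tgt s (p.map φ) t := by
  induction p generalizing s with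
  | nil => exact h
  | cons e p ih => exact ⟨h.1, ih h.2⟩

/-- The support of a non-zero circulation contains a closed walk without repeated edges: every
edge of the support has a successor in the support, and following successors becomes periodic. -/
lemma exists_closed_walk [Fintype E] [DecidableEq V] {f : E → ℝ} (hf : ∀ e, 0 ≤ f e)
    (hcons : ∀ w, ∑ e with src e = w, f e = ∑ e with tgt e = w, f e) {e₀ : E} (he₀ : f e₀ ≠ 0) :
    ∃ (C : List E) (s : V), C ≠ [] ∧ C.Nodup ∧ IsWalk src tgt s C s ∧ ∀ e ∈ C, 0 < f e := by
  have hnext : ∀ e : {e // 0 < f e}, ∃ e' : {e // 0 < f e}, src e'.1 = tgt e.1 := by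
    rintro ⟨e, he⟩
    have h1 : 0 < ∑ e' with src e' = tgt e, f e' := by
      rw [hcons]
      exact he.trans_le (Finset.single_le_sum (f := f) (fun i _ => hf i) (by simp))
    obtain ⟨e', he', hne⟩ := Finset.exists_ne_zero_of_sum_ne_zero h1.ne'
    exact ⟨⟨e', lt_of_le_of_ne (hf e') hne.symm⟩, by simpa using he'⟩
  choose g hg using hnext
  let z : {e // 0 < f e} := ⟨e₀, lt_of_le_of_ne (hf e₀) he₀.symm⟩
  obtain ⟨y, hy⟩ : ∃ y, y ∈ Function.periodicPts g := by
    obtain ⟨i, j, hij, h⟩ := Finite.exists_ne_map_eq_of_infinite fun i : ℕ => g^[i] z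
    wlog hlt : i < j generalizing i j
    · exact this j i hij.symm h.symm (by omega)
    refine ⟨g^[i] z, Function.mk_mem_periodicPts (Nat.sub_pos_of_lt hlt) ?_⟩
    change g^[j - i] (g^[i] z) = g^[i] z
    rw [← Function.iterate_add_apply, Nat.sub_add_cancel hlt.le]
    exact h.symm
  have hpos := Function.minimalPeriod_pos_of_mem_periodicPts hy
  set k := Function.minimalPeriod g y with hk
  refine ⟨((List.range k).map fun i => g^[i] y).map Subtype.val, src y.1, ?_, ?_, ?_, ?_⟩
  · refine List.ne_nil_of_length_pos ?_
    rw [List.length_map, List.length_map, List.length_range]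
    exact hpos
  · refine List.Nodup.map Subtype.val_injective ?_
    refine List.Nodup.map_on ?_ List.nodup_range
    intro a ha b hb hab
    exact Function.iterate_injOn_Iio_minimalPeriod (f := g) (x := y)
      (by simpa using ha) (by simpa using hb) hab
  · have h := isWalk_iterate (src := src ∘ Subtype.val) (tgt := tgt ∘ Subtype.val) g hg y k
    rw [Function.iterate_minimalPeriod] at h
    exact isWalk_map Subtype.val h
  · intro e he
    obtain ⟨e', -, rfl⟩ := List.mem_map.1 he
    exact e'.2

/-- A circulation is a non-negative combination of at most `|E|` closed walks of length at most
`|E|`.  The decomposition is recorded through the sums `∑ e, f e * g e`. -/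
theorem exists_walk_decomposition [Fintype E] [DecidableEq V] (f : E → ℝ) (hf : ∀ e, 0 ≤ f e)
    (hcons : ∀ w, ∑ e with src e = w, f e = ∑ e with tgt e = w, f e) :
    ∃ D : List (ℝ × List E), D.length ≤ Fintype.card E ∧
      (∀ d ∈ D, 0 ≤ d.1 ∧ d.2.length ≤ Fintype.card E ∧ ∃ s, IsWalk src tgt s d.2 s) ∧
      ∀ g : E → ℝ, ∑ e, f e * g e = (D.map fun d => d.1 * (d.2.map g).sum).sum := by
  classical
  suffices H : ∀ (k : ℕ) (f : E → ℝ), (∀ e, 0 ≤ f e) →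
      (∀ w, ∑ e with src e = w, f e = ∑ e with tgt e = w, f e) →
      (Finset.univ.filter fun e => f e ≠ 0).card ≤ k →
      ∃ D : List (ℝ × List E), D.length ≤ k ∧
        (∀ d ∈ D, 0 ≤ d.1 ∧ d.2.length ≤ Fintype.card E ∧ ∃ s, IsWalk src tgt s d.2 s) ∧
        ∀ g : E → ℝ, ∑ e, f e * g e = (D.map fun d => d.1 * (d.2.map g).sum).sum from
    H _ f hf hcons (Finset.card_le_univ _)
  intro k
  induction k with
  | zero =>
    intro f hf hcons hk
    refine ⟨[], le_rfl, by simp, fun g => ?_⟩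
    have h0 : ∀ e, f e = 0 := by simpa [Finset.filter_eq_empty_iff] using hk
    simp [h0]
  | succ k ih =>
    intro f hf hcons hk
    by_cases h0 : ∀ e, f e = 0
    · exact ⟨[], by simp, by simp, fun g => by simp [h0]⟩
    push Not at h0
    obtain ⟨e₀, he₀⟩ := h0
    obtain ⟨C, s, hC, hnd, hw, hpos⟩ := exists_closed_walk hf hcons he₀
    obtain ⟨e₁, he₁, hmin⟩ := Finset.exists_min_image C.toFinset f
      (List.toFinset_nonempty_iff _ |>.2 hC)
    have he₁' : e₁ ∈ C := List.mem_toFinset.1 he₁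
    have hsub : ∀ g : E → ℝ, ∑ e, (f e - if e ∈ C then f e₁ else 0) * g e =
        ∑ e, f e * g e - f e₁ * (C.map g).sum := by
      intro g
      have h1 : ∑ e, (if e ∈ C then f e₁ else 0) * g e = f e₁ * (C.map g).sum := by
        rw [← List.sum_toFinset g hnd, Finset.mul_sum]
        simp [ite_mul, ← List.mem_toFinset]
      rw [← h1, ← Finset.sum_sub_distrib]
      exact Finset.sum_congr rfl fun e _ => sub_mul _ _ _
    have hlen : C.length ≤ Fintype.card E := hnd.length_le_card
    have hnonneg : ∀ e, 0 ≤ f e - if e ∈ C then f e₁ else 0 := by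
      intro e
      split_ifs with he
      · exact sub_nonneg.2 (hmin e (List.mem_toFinset.2 he))
      · simpa using hf e
    have hcons' : ∀ w, ∑ e with src e = w, (f e - if e ∈ C then f e₁ else 0) =
        ∑ e with tgt e = w, (f e - if e ∈ C then f e₁ else 0) := by
      intro w
      have h1 := hsub fun e => if src e = w then 1 else 0
      have h2 := hsub fun e => if tgt e = w then 1 else 0
      have h3 := hw.balance w
      have h4 := hcons w
      simp only [mul_ite, mul_one, mul_zero, ← Finset.sum_filter] at h1 h2
      rw [h1, h2, h4, add_right_cancel h3]
    have hss : (Finset.univ.filter fun e => (f e - if e ∈ C then f e₁ else 0) ≠ 0) ⊂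
        Finset.univ.filter fun e => f e ≠ 0 := by
      refine (Finset.ssubset_iff_of_subset fun e he => ?_).2 ⟨e₁, ?_, ?_⟩
      · simp only [Finset.mem_filter, Finset.mem_univ, true_and] at he ⊢
        by_cases heC : e ∈ C
        · exact (hpos e heC).ne'
        · simpa [heC] using he
      · simpa using (hpos e₁ he₁').ne'
      · simp [he₁']
    have hcard := Finset.card_lt_card hss
    obtain ⟨D, hD, hDw, hDs⟩ := ih _ hnonneg hcons' (by omega)
    refine ⟨(f e₁, C) :: D, by simpa using hD, ?_, fun g => ?_⟩
    · intro d hd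
      rcases List.mem_cons.1 hd with rfl | hd
      · exact ⟨hf _, hlen, s, hw⟩
      · exact hDw d hd
    · rw [List.map_cons, List.sum_cons, ← hDs, hsub]
      ring

end Circulation

/-! ### Edit paths -/

section EditPath

variable {α : Type*}

/-- The word spelled by the first components of an edit path. -/
def srcWord (p : List (EditOp α)) : List α := p.filterMap fun e => e.1.1

/-- The word spelled by the second components of an edit path. -/
def tgtWord (p : List (EditOp α)) : List α := p.filterMap fun e => e.1.2

@[simp] lemma srcWord_nil : srcWord ([] : List (EditOp α)) = [] := rfl
@[simp] lemma tgtWord_nil : tgtWord ([] : List (EditOp α)) = [] := rfl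
@[simp] lemma srcWord_append (p q : List (EditOp α)) :
    srcWord (p ++ q) = srcWord p ++ srcWord q := List.filterMap_append
@[simp] lemma tgtWord_append (p q : List (EditOp α)) :
    tgtWord (p ++ q) = tgtWord p ++ tgtWord q := List.filterMap_append

lemma srcWord_cons (e : EditOp α) (p : List (EditOp α)) :
    srcWord (e :: p) = e.1.1.toList ++ srcWord p := by
  rcases e with ⟨⟨_ | a, b⟩, h⟩ <;> rfl

lemma tgtWord_cons (e : EditOp α) (p : List (EditOp α)) :
    tgtWord (e :: p) = e.1.2.toList ++ tgtWord p := by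
  rcases e with ⟨⟨a, _ | b⟩, h⟩ <;> rfl

lemma srcWord_flatMap {ι : Type*} (l : List ι) (p : ι → List (EditOp α)) :
    srcWord (l.flatMap p) = l.flatMap fun c => srcWord (p c) := by
  induction l with
  | nil => rfl
  | cons c l ih => simp [ih]

lemma tgtWord_flatMap {ι : Type*} (l : List ι) (p : ι → List (EditOp α)) :
    tgtWord (l.flatMap p) = l.flatMap fun c => tgtWord (p c) := by
  induction l with
  | nil => rfl
  | cons c l ih => simp [ih]

lemma length_srcWord_le (p : List (EditOp α)) : (srcWord p).length ≤ p.length :=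
  List.length_filterMap_le _ _

lemma length_tgtWord_le (p : List (EditOp α)) : (tgtWord p).length ≤ p.length :=
  List.length_filterMap_le _ _

/-- The deletion of a letter. -/
def delOp (a : α) : EditOp α := ⟨(some a, none), by simp⟩

/-- The insertion of a letter. -/
def insOp (a : α) : EditOp α := ⟨(none, some a), by simp⟩

variable [DecidableEq α]

lemma opWeight_nonneg (e : EditOp α) : 0 ≤ opWeight e := by
  unfold opWeight; split_ifs <;> norm_num

lemma opWeight_le_one (e : EditOp α) : opWeight e ≤ 1 := by
  unfold opWeight; split_ifs <;> norm_num

@[simp] lemma opWeight_delOp (a : α) : opWeight (delOp a) = 1 := by simp [opWeight, delOp]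
@[simp] lemma opWeight_insOp (a : α) : opWeight (insOp a) = 1 := by simp [opWeight, insOp]

@[simp] lemma pathWeight_nil : pathWeight ([] : List (EditOp α)) = 0 := rfl

@[simp] lemma pathWeight_cons (e : EditOp α) (p : List (EditOp α)) :
    pathWeight (e :: p) = opWeight e + pathWeight p := by simp [pathWeight]

@[simp] lemma pathWeight_append (p q : List (EditOp α)) :
    pathWeight (p ++ q) = pathWeight p + pathWeight q := by simp [pathWeight]

lemma pathWeight_flatMap {ι : Type*} (l : List ι) (p : ι → List (EditOp α)) :
    pathWeight (l.flatMap p) = (l.map fun c => pathWeight (p c)).sum := by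
  induction l with
  | nil => rfl
  | cons c l ih => simp [ih]

lemma pathWeight_nonneg (p : List (EditOp α)) : 0 ≤ pathWeight p := by
  induction p with
  | nil => simp
  | cons e p ih => rw [pathWeight_cons]; exact add_nonneg (opWeight_nonneg e) ih

lemma pathWeight_le_length (p : List (EditOp α)) : pathWeight p ≤ p.length := by
  induction p with
  | nil => simp
  | cons e p ih =>
    rw [pathWeight_cons, List.length_cons, Nat.cast_succ]
    linarith [opWeight_le_one e]

lemma pathCost_nonneg (p : List (EditOp α)) : 0 ≤ pathCost p :=
  div_nonneg (pathWeight_nonneg p) (Nat.cast_nonneg _)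

lemma pathCost_le_one (p : List (EditOp α)) : pathCost p ≤ 1 :=
  div_le_one_of_le₀ (pathWeight_le_length p) (Nat.cast_nonneg _)

lemma ned_le_pathCost {p : List (EditOp α)} {u v : List α} (h : IsEditPath p u v) :
    ned u v ≤ pathCost p :=
  csInf_le ⟨0, by rintro _ ⟨q, -, rfl⟩; exact pathCost_nonneg q⟩ ⟨p, h, rfl⟩

lemma ned_nonneg (u v : List α) : 0 ≤ ned u v :=
  Real.sInf_nonneg (by rintro _ ⟨q, -, rfl⟩; exact pathCost_nonneg q)

/-- An edit path between subwords extends to the whole words by deletions. -/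
lemma exists_pad_source {u u' : List α} (h : u.Sublist u') :
    ∀ p : List (EditOp α), srcWord p = u → ∃ q : List (EditOp α), srcWord q = u' ∧
      tgtWord q = tgtWord p ∧ q.length + u.length = p.length + u'.length ∧
      pathWeight q + u.length = pathWeight p + u'.length := by
  induction h with
  | slnil => exact fun p hp => ⟨p, hp, rfl, rfl, rfl⟩
  | cons a _ ih =>
    intro p hp
    obtain ⟨q, h1, h2, h3, h4⟩ := ih p hp
    refine ⟨delOp a :: q, by simp [srcWord_cons, delOp, h1], by simp [tgtWord_cons, delOp, h2],
      by simp; omega, ?_⟩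
    simp only [pathWeight_cons, opWeight_delOp, List.length_cons, Nat.cast_succ]
    linarith
  | cons_cons a _ ih =>
    intro p hp
    obtain ⟨p₁, p₂, rfl, h₁, h₂⟩ := (List.filterMap_eq_append_iff (L₁ := [a])).1 hp
    obtain ⟨q, h1, h2, h3, h4⟩ := ih p₂ h₂
    refine ⟨p₁ ++ q, ?_, by simp [h2], by simp; omega, ?_⟩
    · rw [srcWord_append, h1, srcWord, h₁]; rfl
    · simp only [pathWeight_append, List.length_cons, Nat.cast_succ]
      linarith

/-- An edit path between subwords extends to the whole words by insertions. -/
lemma exists_pad_target {v v' : List α} (h : v.Sublist v') :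
    ∀ p : List (EditOp α), tgtWord p = v → ∃ q : List (EditOp α), srcWord q = srcWord p ∧
      tgtWord q = v' ∧ q.length + v.length = p.length + v'.length ∧
      pathWeight q + v.length = pathWeight p + v'.length := by
  induction h with
  | slnil => exact fun p hp => ⟨p, rfl, hp, rfl, rfl⟩
  | cons a _ ih =>
    intro p hp
    obtain ⟨q, h1, h2, h3, h4⟩ := ih p hp
    refine ⟨insOp a :: q, by simp [srcWord_cons, insOp, h1], by simp [tgtWord_cons, insOp, h2],
      by simp; omega, ?_⟩
    simp only [pathWeight_cons, opWeight_insOp, List.length_cons, Nat.cast_succ]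
    linarith
  | cons_cons a _ ih =>
    intro p hp
    obtain ⟨p₁, p₂, rfl, h₁, h₂⟩ := (List.filterMap_eq_append_iff (L₁ := [a])).1 hp
    obtain ⟨q, h1, h2, h3, h4⟩ := ih p₂ h₂
    refine ⟨p₁ ++ q, by simp [h1], ?_, by simp; omega, ?_⟩
    · rw [tgtWord_append, h2, tgtWord, h₁]; rfl
    · simp only [pathWeight_append, List.length_cons, Nat.cast_succ]
      linarith

lemma exists_pad {p : List (EditOp α)} {u v : List α} (hu : (srcWord p).Sublist u)
    (hv : (tgtWord p).Sublist v) :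
    ∃ q : List (EditOp α), IsEditPath q u v ∧
      (q.length : ℝ) + (srcWord p).length + (tgtWord p).length = p.length + u.length + v.length ∧
      pathWeight q + (srcWord p).length + (tgtWord p).length =
        pathWeight p + u.length + v.length := by
  obtain ⟨q, h1, h2, h3, h4⟩ := exists_pad_source hu p rfl
  obtain ⟨q', h1', h2', h3', h4'⟩ := exists_pad_target hv q h2
  refine ⟨q', ⟨h1'.trans h1, h2'⟩, ?_, by linarith⟩
  exact_mod_cast (by omega :
    q'.length + (srcWord p).length + (tgtWord p).length = p.length + u.length + v.length)

lemma exists_isEditPath (u v : List α) : ∃ p : List (EditOp α), IsEditPath p u v := by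
  obtain ⟨q, hq, -⟩ := exists_pad (p := []) (List.nil_sublist u) (List.nil_sublist v)
  exact ⟨q, hq⟩

lemma ned_le_one (u v : List α) : ned u v ≤ 1 := by
  obtain ⟨p, hp⟩ := exists_isEditPath u v
  exact (ned_le_pathCost hp).trans (pathCost_le_one p)

end EditPath

/-! ### Walks in cyclic edit graphs as edit paths -/

section CyclicReading

variable {α : Type*} {u v : List α}

/-- The word `w` is read off the cyclic word `u` from the position `l` on. -/
def CycReads (u : List α) : CycPos u → List α → Prop
  | _, [] => True
  | l, a :: w => (∃ h : l.val < u.length, u.get ⟨l.val, h⟩ = a) ∧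
      CycReads u (CycPos.mk u (l.val + 1)) w

lemma CycPos.mk_val (l : CycPos u) : CycPos.mk u l.val = l :=
  Fin.ext (Nat.mod_eq_of_lt l.2)

lemma CycPos.val_mk_of_lt {l : ℕ} (h : l < u.length) : (CycPos.mk u l).val = l :=
  Nat.mod_eq_of_lt (by omega)

lemma CycPos.mk_length : CycPos.mk u u.length = CycPos.mk u 0 := by
  rcases Nat.eq_zero_or_pos u.length with h | h
  · rw [h]
  · exact Fin.ext (by simp [CycPos.mk, max_eq_left (Nat.succ_le_of_lt h)])

/-- The words read off a cyclic word are subwords of its powers; the additional period makes up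
for the initial position. -/
lemma CycReads.sublist_replicate {w : List α} {l : CycPos u} (h : CycReads u l w) {A : ℕ}
    (hA : w = [] ∨ w.length + u.length ≤ A * u.length) :
    w.Sublist (List.replicate A u).flatten := by
  have key : ∀ (w : List α) (l : CycPos u) (M : ℕ), CycReads u l w →
      w.length + l.val ≤ u.length + M * u.length →
      w.Sublist (u.drop l.val ++ (List.replicate M u).flatten) := by
    intro w
    induction w with
    | nil => exact fun _ _ _ _ => List.nil_sublist _
    | cons a w ih =>
      rintro l M ⟨⟨hl, rfl⟩, hw⟩ hlen
      rw [List.drop_eq_getElem_cons hl, List.cons_append]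
      refine List.Sublist.cons_cons _ ?_
      rw [List.length_cons] at hlen
      rcases Nat.lt_or_ge (l.val + 1) u.length with h1 | h1
      · have := ih _ M hw (by rw [CycPos.val_mk_of_lt h1]; omega)
        rwa [CycPos.val_mk_of_lt h1] at this
      · have h2 : l.val + 1 = u.length := by omega
        rw [h2, CycPos.mk_length] at hw
        have h0 : (CycPos.mk u 0).val = 0 := CycPos.val_mk_of_lt (by omega)
        cases M with
        | zero =>
          have : w = [] := List.length_eq_zero_iff.1 (by omega)
          rw [this]; exact List.nil_sublist _
        | succ M =>
          have := ih _ M hw (by rw [h0]; rw [Nat.succ_mul] at hlen; omega)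
          rw [h0, List.drop_zero] at this
          rw [h2, List.drop_length, List.nil_append, List.replicate_succ, List.flatten_cons]
          exact this
  rcases hA with rfl | hA
  · exact List.nil_sublist _
  rcases Nat.eq_zero_or_pos w.length with h0 | h0
  · rw [List.length_eq_zero_iff.1 h0]; exact List.nil_sublist _
  cases A with
  | zero => rw [Nat.zero_mul] at hA; omega
  | succ A =>
    rw [Nat.succ_mul] at hA
    have hl : l.val < max u.length 1 := l.2
    cases w with
    | nil => exact List.nil_sublist _
    | cons a w =>
      obtain ⟨⟨hl, -⟩, -⟩ := id h
      refine (key _ l A h (by omega)).trans ?_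
      rw [List.replicate_succ, List.flatten_cons]
      exact (List.drop_sublist _ _).append_right _

lemma cycReads_replicate (A : ℕ) : CycReads u (CycPos.mk u 0) (List.replicate A u).flatten := by
  induction A with
  | zero => exact trivial
  | succ A ih =>
    have key : ∀ d l, l + d = u.length →
        CycReads u (CycPos.mk u l) (u.drop l ++ (List.replicate A u).flatten) := by
      intro d
      induction d with
      | zero =>
        intro l hl
        obtain rfl : l = u.length := hl
        rw [List.drop_length, List.nil_append, CycPos.mk_length]
        exact ih
      | succ d ihd =>
        intro l hl
        have hl' : l < u.length := by omega
        rw [List.drop_eq_getElem_cons hl', List.cons_append]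
        refine ⟨⟨by rwa [CycPos.val_mk_of_lt hl'], ?_⟩, ?_⟩
        · simp [CycPos.val_mk_of_lt hl']
        · rw [CycPos.val_mk_of_lt hl']
          exact ihd (l + 1) (by omega)
    have := key u.length 0 (by omega)
    rwa [List.drop_zero, ← List.flatten_cons, ← List.replicate_succ] at this

namespace CycEdge

/-- The edit operation of an edge of the cyclic edit graph. -/
def op : CycEdge u v → EditOp α
  | del l _ => delOp (u.get l)
  | ins _ k => insOp (v.get k)
  | diag l k => ⟨(some (u.get l), some (v.get k)), by simp⟩

lemma opWeight_op [DecidableEq α] (e : CycEdge u v) : opWeight e.op = e.weight := by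
  cases e <;> simp [op, weight, opWeight, delOp, insOp]

lemma weight_nonneg [DecidableEq α] (e : CycEdge u v) : 0 ≤ e.weight := by
  rw [← opWeight_op]; exact opWeight_nonneg _

lemma weight_le_one [DecidableEq α] (e : CycEdge u v) : e.weight ≤ 1 := by
  rw [← opWeight_op]; exact opWeight_le_one _

lemma readsSource_nonneg (e : CycEdge u v) : 0 ≤ e.readsSource := by
  cases e <;> simp [readsSource]

lemma readsSource_le_one (e : CycEdge u v) : e.readsSource ≤ 1 := by
  cases e <;> simp [readsSource]

lemma readsTarget_nonneg (e : CycEdge u v) : 0 ≤ e.readsTarget := by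
  cases e <;> simp [readsTarget]

lemma readsTarget_le_one (e : CycEdge u v) : e.readsTarget ≤ 1 := by
  cases e <;> simp [readsTarget]

end CycEdge

lemma pathWeight_map_op [DecidableEq α] (C : List (CycEdge u v)) :
    pathWeight (C.map CycEdge.op) = (C.map CycEdge.weight).sum := by
  induction C with
  | nil => rfl
  | cons e C ih => simp [ih, CycEdge.opWeight_op]

lemma length_srcWord_map_op (C : List (CycEdge u v)) :
    ((srcWord (C.map CycEdge.op)).length : ℝ) = (C.map CycEdge.readsSource).sum := by
  induction C with
  | nil => simp
  | cons e C ih =>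
    rw [List.map_cons, List.map_cons, List.sum_cons, srcWord_cons, List.length_append,
      Nat.cast_add, ih]
    cases e <;> simp [CycEdge.op, CycEdge.readsSource, delOp, insOp]

lemma length_tgtWord_map_op (C : List (CycEdge u v)) :
    ((tgtWord (C.map CycEdge.op)).length : ℝ) = (C.map CycEdge.readsTarget).sum := by
  induction C with
  | nil => simp
  | cons e C ih =>
    rw [List.map_cons, List.map_cons, List.sum_cons, tgtWord_cons, List.length_append,
      Nat.cast_add, ih]
    cases e <;> simp [CycEdge.op, CycEdge.readsTarget, delOp, insOp]

lemma IsWalk.cycReads {C : List (CycEdge u v)} {s t : CycVertex u v}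
    (h : IsWalk CycEdge.src CycEdge.tgt s C t) :
    CycReads u s.1 (srcWord (C.map CycEdge.op)) ∧
      CycReads v s.2 (tgtWord (C.map CycEdge.op)) := by
  induction C generalizing s with
  | nil => exact ⟨trivial, trivial⟩
  | cons e C ih =>
    obtain ⟨rfl, h⟩ := h
    obtain ⟨h1, h2⟩ := ih h
    rw [List.map_cons, srcWord_cons, tgtWord_cons]
    cases e with
    | del l k =>
      refine ⟨⟨⟨?_, ?_⟩, ?_⟩, h2⟩ <;> simp only [CycEdge.src, CycPos.val_mk_of_lt l.2]
      exacts [l.2, h1]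
    | ins l k =>
      refine ⟨h1, ⟨?_, ?_⟩, ?_⟩ <;> simp only [CycEdge.src, CycPos.val_mk_of_lt k.2]
      exacts [k.2, h2]
    | diag l k =>
      refine ⟨⟨⟨?_, ?_⟩, ?_⟩, ⟨?_, ?_⟩, ?_⟩ <;>
        simp only [CycEdge.src, CycPos.val_mk_of_lt l.2, CycPos.val_mk_of_lt k.2]
      exacts [l.2, h1, k.2, h2]

lemma CycReads.ne_nil {l : CycPos u} {w : List α} (h : CycReads u l w) (hw : w ≠ []) :
    u ≠ [] := by
  rintro rfl
  cases w with
  | nil => exact hw rfl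
  | cons a w => exact absurd h.1.1 (Nat.not_lt_zero _)

/-- Removing at least `2 |u|` of `m` copies of a word read off the cyclic word `u` leaves a subword
of a power of `u` that is no longer than the `m` copies. -/
lemma CycReads.sublist_of_copies {l : CycPos u} {m m' M : ℕ}
    (hm : m' = m - M) (hM : 2 * u.length ≤ M) {w : List α} {c : ℕ} (hw : w.length = m' * c)
    (hu : 0 < c → u ≠ []) (h : CycReads u l w) :
    w.Sublist (List.replicate (m * c / u.length) u).flatten := by
  refine h.sublist_replicate ?_
  rcases Nat.eq_zero_or_pos c with rfl | hc
  · left; exact List.length_eq_zero_iff.1 (by simpa using hw)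
  rcases Nat.le_total m M with h1 | h1
  · left
    refine List.length_eq_zero_iff.1 ?_
    rw [hw, hm, Nat.sub_eq_zero_of_le h1, Nat.zero_mul]
  · right
    have h2 : m' * c + M * c = m * c := by rw [← Nat.add_mul, hm, Nat.sub_add_cancel h1]
    have h3 : M ≤ M * c := Nat.le_mul_of_pos_right _ hc
    have h4 := Nat.lt_div_mul_add (a := m * c) (List.length_pos_iff.2 (hu hc))
    omega

/-- A circulation of total value `N` in the cyclic edit graph of `u` and `v` is realized, up to a
bounded error, by an edit path between subwords of powers of `u` and `v`, which are no longer
than the circulation prescribes. -/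
theorem exists_cell_path [DecidableEq α] (u v : List α) : ∃ K : ℝ, 0 ≤ K ∧
    ∀ f : CycEdge u v → ℝ, (∀ e, 0 ≤ f e) →
    (∀ w, ∑ e with CycEdge.src e = w, f e = ∑ e with CycEdge.tgt e = w, f e) →
    ∀ N : ℝ, 0 ≤ N → ∃ (p : List (EditOp α)) (A B : ℕ),
      (srcWord p).Sublist (List.replicate A u).flatten ∧
      (tgtWord p).Sublist (List.replicate B v).flatten ∧
      (A * u.length : ℝ) ≤ N * ∑ e, f e * e.readsSource ∧
      (B * v.length : ℝ) ≤ N * ∑ e, f e * e.readsTarget ∧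
      pathWeight p ≤ N * ∑ e, f e * e.weight ∧
      N * ∑ e, f e ≤ p.length + K ∧
      N * ∑ e, f e * e.readsSource ≤ (srcWord p).length + K ∧
      N * ∑ e, f e * e.readsTarget ≤ (tgtWord p).length + K := by
  -- The number of copies of each closed walk that are given up.
  set M : ℕ := 2 * (u.length + v.length) with hM
  set c₀ : ℕ := Fintype.card (CycEdge u v) with hc₀
  have hK : (0 : ℝ) ≤ c₀ * (M + 1) := by positivity
  refine ⟨c₀ * (c₀ * (M + 1)), by positivity, fun f hf hcons N hN => ?_⟩
  obtain ⟨D, hD, hDw, hDs⟩ := exists_walk_decomposition f hf hcons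
  have hone : ∑ e, f e = (D.map fun d => d.1 * (d.2.map fun _ => (1 : ℝ)).sum).sum := by
    rw [← hDs]; simp
  rw [hone, hDs, hDs, hDs]
  have hDr : (D.length : ℝ) ≤ c₀ := by exact_mod_cast hD
  suffices H : ∃ (p : List (EditOp α)) (A B : ℕ),
      (srcWord p).Sublist (List.replicate A u).flatten ∧
      (tgtWord p).Sublist (List.replicate B v).flatten ∧
      (A * u.length : ℝ) ≤ N * (D.map fun d => d.1 * (d.2.map CycEdge.readsSource).sum).sum ∧
      (B * v.length : ℝ) ≤ N * (D.map fun d => d.1 * (d.2.map CycEdge.readsTarget).sum).sum ∧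
      pathWeight p ≤ N * (D.map fun d => d.1 * (d.2.map CycEdge.weight).sum).sum ∧
      N * (D.map fun d => d.1 * (d.2.map fun _ => (1 : ℝ)).sum).sum ≤
        p.length + D.length * (c₀ * (M + 1)) ∧
      N * (D.map fun d => d.1 * (d.2.map CycEdge.readsSource).sum).sum ≤
        (srcWord p).length + D.length * (c₀ * (M + 1)) ∧
      N * (D.map fun d => d.1 * (d.2.map CycEdge.readsTarget).sum).sum ≤
        (tgtWord p).length + D.length * (c₀ * (M + 1)) by
    obtain ⟨p, A, B, h1, h2, h3, h4, h5, h6, h7, h8⟩ := H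
    have := mul_le_mul_of_nonneg_right hDr hK
    exact ⟨p, A, B, h1, h2, h3, h4, h5, by linarith, by linarith, by linarith⟩
  clear hone hDs hD hDr
  induction D with
  | nil => exact ⟨[], 0, 0, by simp, by simp, by simp, by simp, by simp, by simp, by simp, by simp⟩
  | cons d D ih =>
    obtain ⟨p, A, B, h1, h2, h3, h4, h5, h6, h7, h8⟩ :=
      ih fun d hd => hDw d (List.mem_cons_of_mem _ hd)
    obtain ⟨hd0, hdl, s, hs⟩ := hDw d List.mem_cons_self
    obtain ⟨δ, C⟩ := d
    dsimp only at hd0 hdl hs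
    set m := ⌊N * δ⌋₊ with hm
    set m' := m - M with hm'
    set q := (List.replicate m' C).flatten with hq
    have hNδ : 0 ≤ N * δ := mul_nonneg hN hd0
    have hm1 : (m : ℝ) ≤ N * δ := Nat.floor_le hNδ
    have hm2 : N * δ ≤ m' + (M + 1) := by
      have h9 := (Nat.lt_floor_add_one (N * δ)).le
      have h10 : (m : ℝ) ≤ m' + M := by exact_mod_cast (by omega : m ≤ m' + M)
      linarith
    have hm3 : (m' : ℝ) ≤ m := by exact_mod_cast Nat.sub_le _ _
    have hsum : ∀ g : CycEdge u v → ℝ, (q.map g).sum = m' * (C.map g).sum := by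
      intro g
      simp [hq, List.map_flatten, List.sum_flatten]
    have hCl : (C.length : ℝ) ≤ c₀ := by exact_mod_cast hdl
    have hbd : ∀ g : CycEdge u v → ℝ, (∀ e, 0 ≤ g e) → (∀ e, g e ≤ 1) →
        m' * (C.map g).sum ≤ N * δ * (C.map g).sum ∧ m * (C.map g).sum ≤ N * δ * (C.map g).sum ∧
        N * δ * (C.map g).sum ≤ m' * (C.map g).sum + c₀ * (M + 1) := by
      intro g h0 h1
      have hS0 : 0 ≤ (C.map g).sum := List.sum_nonneg (by simpa using fun e _ => h0 e)
      have hS1 : (C.map g).sum ≤ c₀ := by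
        refine le_trans ?_ hCl
        have := List.sum_le_card_nsmul (C.map g) 1 (by simpa using fun e _ => h1 e)
        simpa using this
      refine ⟨mul_le_mul_of_nonneg_right (hm3.trans hm1) hS0,
        mul_le_mul_of_nonneg_right hm1 hS0, ?_⟩
      have h11 := mul_le_mul_of_nonneg_right hm2 hS0
      have h12 : (M + 1 : ℝ) * (C.map g).sum ≤ (M + 1) * c₀ :=
        mul_le_mul_of_nonneg_left hS1 (by positivity)
      linarith
    obtain ⟨hr1, hr2⟩ := (hs.replicate m').cycReads
    rw [← hq] at hr1 hr2
    have hls := length_srcWord_map_op q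
    have hlt := length_tgtWord_map_op q
    rw [hsum] at hls hlt
    have hbs := hbd _ CycEdge.readsSource_nonneg CycEdge.readsSource_le_one
    have hbt := hbd _ CycEdge.readsTarget_nonneg CycEdge.readsTarget_le_one
    have hbw := hbd _ CycEdge.weight_nonneg CycEdge.weight_le_one
    have hb1 := hbd _ (fun _ => zero_le_one) (fun _ => le_rfl)
    have hl1 : (q.length : ℝ) = m' * (C.map fun _ => (1 : ℝ)).sum := by
      rw [← hsum]; simp
    have hcs := length_srcWord_map_op C
    have hct := length_tgtWord_map_op C
    rw [← hcs] at hbs hls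
    rw [← hct] at hbt hlt
    set cs := (srcWord (C.map CycEdge.op)).length with hcsdef
    set ct := (tgtWord (C.map CycEdge.op)).length with hctdef
    have hus : 0 < cs → u ≠ [] := fun h => hs.cycReads.1.ne_nil (List.length_pos_iff.1 h)
    have hvs : 0 < ct → v ≠ [] := fun h => hs.cycReads.2.ne_nil (List.length_pos_iff.1 h)
    have hdiv : ∀ a b : ℕ, ((a / b : ℕ) * b : ℝ) ≤ a := fun a b => by
      exact_mod_cast Nat.div_mul_le_self a b
    have hds := hdiv (m * cs) u.length
    have hdt := hdiv (m * ct) v.length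
    rw [Nat.cast_mul] at hds hdt
    refine ⟨q.map CycEdge.op ++ p, m * cs / u.length + A, m * ct / v.length + B,
      ?_, ?_, ?_, ?_, ?_, ?_, ?_, ?_⟩
    · rw [srcWord_append, List.replicate_add, List.flatten_append]
      exact (hr1.sublist_of_copies hm' (by omega) (by exact_mod_cast hls) hus).append h1
    · rw [tgtWord_append, List.replicate_add, List.flatten_append]
      exact (hr2.sublist_of_copies hm' (by omega) (by exact_mod_cast hlt) hvs).append h2
    all_goals
      simp only [List.map_cons, List.sum_cons, List.length_cons, pathWeight_append,
        srcWord_append, tgtWord_append, List.length_append, Nat.cast_add, pathWeight_map_op, hsum,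
        List.length_map, mul_add, add_mul, one_mul, Nat.cast_one, ← mul_assoc, hls, hlt, hl1,
        ← hcs, ← hct] at *
      linarith

end CyclicReading

/-! ### Products of powers -/

section PowWord

variable {α : Type*}

lemma powWord_succ {n : ℕ} (x : Fin (n + 1) → List α) (v : Fin (n + 1) → ℕ) :
    powWord x v = (List.replicate (v 0) (x 0)).flatten ++
      powWord (fun i => x i.succ) fun i => v i.succ := by
  simp [powWord, List.ofFn_succ]

lemma length_powWord {n : ℕ} (x : Fin n → List α) (v : Fin n → ℕ) :
    (powWord x v).length = powLength x v := by
  simp [powWord, powLength, List.length_flatten, List.sum_ofFn, Function.comp_def]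

lemma powLength_add {n : ℕ} (x : Fin n → List α) (v w : Fin n → ℕ) :
    powLength x (v + w) = powLength x v + powLength x w := by
  simp [powLength, add_mul, Finset.sum_add_distrib]

lemma powLength_smul {n : ℕ} (x : Fin n → List α) (t : ℕ) (v : Fin n → ℕ) :
    powLength x (t • v) = t * powLength x v := by
  simp [powLength, Finset.mul_sum, mul_assoc]

lemma powLength_sum {n r : ℕ} (x : Fin n → List α) (t : Fin r → ℕ) (V : Fin r → Fin n → ℕ) :
    powLength x (∑ s, t s • V s) = ∑ s, t s * powLength x (V s) := by
  simp only [powLength, Finset.sum_apply, Finset.sum_mul, Finset.mul_sum, Pi.smul_apply,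
    smul_eq_mul, mul_assoc]
  exact Finset.sum_comm

lemma powWord_sublist {n : ℕ} {x : Fin n → List α} {v w : Fin n → ℕ}
    (h : ∀ i, x i = [] ∨ v i ≤ w i) : (powWord x v).Sublist (powWord x w) := by
  induction n with
  | zero => simp [powWord]
  | succ n ih =>
    rw [powWord_succ, powWord_succ]
    refine List.Sublist.append ?_ (ih fun i => h i.succ)
    rcases h 0 with h | h
    · simp [h]
    · obtain ⟨k, hk⟩ := Nat.exists_eq_add_of_le h
      rw [hk, List.replicate_add, List.flatten_append]
      exact List.sublist_append_left _ _

lemma replicate_append_powWord {n : ℕ} {x : Fin n → List α} {v : Fin n → ℕ} {i : Fin n}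
    (h : ∀ j < i, v j = 0) (k : ℕ) :
    (List.replicate k (x i)).flatten ++ powWord x v =
      powWord x fun j => (if i = j then k else 0) + v j := by
  induction n with
  | zero => exact i.elim0
  | succ n ih =>
    rw [powWord_succ, powWord_succ]
    refine Fin.cases (fun h => ?_) (fun i h => ?_) i h
    · have h1 : (fun j : Fin n => (if (0 : Fin (n + 1)) = j.succ then k else 0) + v j.succ) =
          fun j => v j.succ := funext fun j => by simp [(Fin.succ_ne_zero j).symm]
      rw [h1, if_pos rfl, List.replicate_add, List.flatten_append, List.append_assoc]
    · have h1 := ih (x := fun i => x i.succ) (v := fun i => v i.succ) (i := i)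
        fun j hj => h j.succ (Fin.succ_lt_succ_iff.2 hj)
      simp [h 0 (Fin.succ_pos i), h1]

/-- Subwords of powers of the `x i`, concatenated in an order in which the indices `i` do not
decrease, form a subword of a product of powers. -/
lemma flatMap_sublist_powWord {ι : Type*} {n : ℕ} {x : Fin n → List α} (row : ι → Fin n)
    (w : ι → List α) (A : ι → ℕ) {l : List ι} (hl : l.Pairwise fun c d => row c ≤ row d)
    (hw : ∀ c ∈ l, (w c).Sublist (List.replicate (A c) (x (row c))).flatten) :
    (l.flatMap w).Sublist
      (powWord x fun i => (l.map fun c => if row c = i then A c else 0).sum) := by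
  induction l with
  | nil => simp
  | cons c l ih =>
    obtain ⟨hc, hl⟩ := List.pairwise_cons.1 hl
    rw [List.flatMap_cons]
    simp only [List.map_cons, List.sum_cons]
    rw [← replicate_append_powWord]
    · exact (hw c List.mem_cons_self).append (ih hl fun d hd => hw d (List.mem_cons_of_mem _ hd))
    · intro j hj
      refine List.sum_eq_zero ?_
      intro a ha
      obtain ⟨d, hd, rfl⟩ := List.mem_map.1 ha
      exact if_neg fun h => absurd (hc d hd) (by rw [h]; exact not_le.2 hj)

end PowWord

/-! ### From feasible points to edit paths -/

section FlowToPath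

variable {α : Type*} {n m r : ℕ}

lemma GridStep.lt {c d : Fin n × Fin m} (h : GridStep c d) : c < d := by
  rcases h with ⟨h1, h2⟩ | ⟨h1, h2⟩
  · exact Prod.lt_iff.2 (Or.inl ⟨Fin.lt_def.2 (by omega), h2.ge⟩)
  · exact Prod.lt_iff.2 (Or.inr ⟨h1.ge, Fin.lt_def.2 (by omega)⟩)

lemma pairwise_lt_of_isChain {l : List (Fin n × Fin m)} (h : l.IsChain GridStep) :
    l.Pairwise (· < ·) :=
  List.isChain_iff_pairwise.1 (h.imp fun _ _ => GridStep.lt)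

lemma sum_fiberwise_fst {π : Finset (Fin n × Fin m)} (g : Fin n × Fin m → ℝ) :
    ∑ i, ∑ c ∈ π with c.1 = i, g c = ∑ c ∈ π, g c :=
  Finset.sum_fiberwise π Prod.fst g

lemma sum_fiberwise_snd {π : Finset (Fin n × Fin m)} (g : Fin n × Fin m → ℝ) :
    ∑ i, ∑ c ∈ π with c.2 = i, g c = ∑ c ∈ π, g c :=
  Finset.sum_fiberwise π Prod.snd g

/-- `∑ j, |y j| ∑ s, τ s (V s) j = ∑ s, τ s ℓ(V s)`. -/
lemma sum_length_mul_sum (y : Fin m → List α) (V : Fin r → Fin m → ℕ) (τ : Fin r → ℝ) :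
    ∑ j, ((y j).length : ℝ) * ∑ s, τ s * (V s j : ℝ) = ∑ s, τ s * (powLength y (V s) : ℝ) := by
  simp only [powLength, Nat.cast_sum, Nat.cast_mul, Finset.mul_sum]
  rw [Finset.sum_comm]
  exact Finset.sum_congr rfl fun s _ => Finset.sum_congr rfl fun j _ => by ring

lemma sum_length_mul_direction {x : Fin n → List α} {v : Fin n → ℕ} (h : powLength x v ≠ 0) :
    ∑ i, ((x i).length : ℝ) * direction x v i = 1 := by
  have h' : (powLength x v : ℝ) ≠ 0 := Nat.cast_ne_zero.2 h
  have h1 : (powLength x v : ℝ) = ∑ i, (v i : ℝ) * (x i).length := by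
    rw [powLength, Nat.cast_sum]
    simp
  rw [← div_self h']
  nth_rewrite 1 [h1]
  rw [Finset.sum_div]
  exact Finset.sum_congr rfl fun i _ => by rw [direction]; ring

variable [DecidableEq α]

/-- A feasible point for the direction of `ν`, scaled by `N = ℓ(ν) / λ`, is realized by an edit
path from `x ^ (u₀ + ν)` to a word of the target language, up to an error independent of `ν`. -/
theorem exists_path_of_lpFeasible (x : Fin n → List α) (y : Fin m → List α)
    (u₀ : Fin n → ℕ) (v₀ : Fin m → ℕ) (V : Fin r → Fin m → ℕ) :
    ∃ K : ℝ, 0 ≤ K ∧ ∀ (π : Finset (Fin n × Fin m)) (f : FlowVar x y) (τ : Fin r → ℝ) (lam : ℝ)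
      (ν : Fin n → ℕ), IsInterleaving π → powLength x ν ≠ 0 →
      LPFeasible x y V (direction x ν) π f τ lam →
      ∃ (t : Fin r → ℕ) (p : List (EditOp α)),
        IsEditPath p (powWord x (u₀ + ν)) (powWord y (v₀ + ∑ s, t s • V s)) ∧
        pathWeight p ≤ powLength x ν / lam * lpObjective x y π f + K ∧
        powLength x ν / lam ≤ p.length + K := by
  choose K hK0 hK using fun c : Fin n × Fin m => exists_cell_path (x c.1) (y c.2)
  have hKs : 0 ≤ ∑ c, K c := Finset.sum_nonneg fun c _ => hK0 c
  refine ⟨2 * ∑ c, K c + powLength x u₀ + powLength y v₀ + ∑ s, powLength y (V s),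
    by positivity, fun π f τ lam ν hπ hν hf => ?_⟩
  obtain ⟨l, hl, -, -, rfl⟩ := hπ
  set π := l.toFinset with hπdef
  set L := powLength x ν with hL
  have hL0 : (L : ℝ) ≠ 0 := Nat.cast_ne_zero.2 hν
  set N : ℝ := L / lam with hN
  have hlam := hf.lam_mem.1
  have hN0 : 0 ≤ N := by positivity
  have hNlam : N * lam = L := div_mul_cancel₀ _ hlam.ne'
  have hcell : ∀ c, ∃ (p : List (EditOp α)) (A B : ℕ), c ∈ π →
      (srcWord p).Sublist (List.replicate A (x c.1)).flatten ∧
      (tgtWord p).Sublist (List.replicate B (y c.2)).flatten ∧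
      (A * (x c.1).length : ℝ) ≤ N * ∑ e, f c e * e.readsSource ∧
      (B * (y c.2).length : ℝ) ≤ N * ∑ e, f c e * e.readsTarget ∧
      pathWeight p ≤ N * ∑ e, f c e * e.weight ∧
      N * ∑ e, f c e ≤ p.length + K c ∧
      N * ∑ e, f c e * e.readsSource ≤ (srcWord p).length + K c ∧
      N * ∑ e, f c e * e.readsTarget ≤ (tgtWord p).length + K c := by
    intro c
    by_cases hc : c ∈ π
    · obtain ⟨p, A, B, h⟩ := hK c (f c) (hf.flow_nonneg c hc) (hf.conservation c hc) N hN0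
      exact ⟨p, A, B, fun _ => h⟩
    · exact ⟨[], 0, 0, fun h => absurd h hc⟩
  choose p A B hp using hcell
  have hlt := pairwise_lt_of_isChain hl
  have hnd : l.Nodup := hlt.imp fun h => h.ne
  have hsum : ∀ g : Fin n × Fin m → ℝ, (l.map g).sum = ∑ c ∈ π, g c := fun g =>
    (List.sum_toFinset g hnd).symm
  have hsumN : ∀ g : Fin n × Fin m → ℕ, (l.map g).sum = ∑ c ∈ π, g c := fun g =>
    (List.sum_toFinset g hnd).symm
  -- Rounding up makes room for everything that the flow inserts.
  set t : Fin r → ℕ := fun s => ⌈N * τ s⌉₊ with ht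
  set P := l.flatMap p with hP
  have hKπ : ∑ c ∈ π, K c ≤ ∑ c, K c :=
    Finset.sum_le_sum_of_subset_of_nonneg (Finset.subset_univ _) fun c _ _ => hK0 c
  have hxlen : ∀ i, x i = [] ∨ 0 < ((x i).length : ℝ) := fun i => by
    rcases List.eq_nil_or_concat (x i) with h | ⟨_, _, h⟩
    · exact Or.inl h
    · right; rw [h]; simp; positivity
  have hylen : ∀ j, y j = [] ∨ 0 < ((y j).length : ℝ) := fun j => by
    rcases List.eq_nil_or_concat (y j) with h | ⟨_, _, h⟩
    · exact Or.inl h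
    · right; rw [h]; simp; positivity
  have hsrc : (srcWord P).Sublist (powWord x (u₀ + ν)) := by
    rw [hP, srcWord_flatMap]
    refine (flatMap_sublist_powWord Prod.fst _ A (hlt.imp fun h => h.le.1)
      fun c hc => (hp c (List.mem_toFinset.2 hc)).1).trans (powWord_sublist fun i => ?_)
    refine (hxlen i).imp_right fun hi => ?_
    rw [hsumN, ← Finset.sum_filter]
    have h1 : (∑ c ∈ π with c.1 = i, (A c : ℝ)) * (x i).length ≤ ν i * (x i).length := by
      rw [Finset.sum_mul]
      calc ∑ c ∈ π with c.1 = i, (A c : ℝ) * (x i).length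
          ≤ ∑ c ∈ π with c.1 = i, N * ∑ e, f c e * e.readsSource := by
            refine Finset.sum_le_sum fun c hc => ?_
            obtain ⟨hc', rfl⟩ := Finset.mem_filter.1 hc
            exact (hp c hc').2.2.1
        _ = (N * lam) * ((ν i : ℝ) / L) * (x i).length := by
            rw [← Finset.mul_sum, hf.source i, direction]; ring
        _ = ν i * (x i).length := by rw [hNlam, mul_div_cancel₀ _ hL0]
    have h2 := le_of_mul_le_mul_right h1 hi
    have h3 : ∑ c ∈ π with c.1 = i, A c ≤ ν i := by exact_mod_cast h2
    exact h3.trans (Nat.le_add_left _ _)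
  have htgt : (tgtWord P).Sublist (powWord y (v₀ + ∑ s, t s • V s)) := by
    rw [hP, tgtWord_flatMap]
    refine (flatMap_sublist_powWord Prod.snd _ B (hlt.imp fun h => h.le.2)
      fun c hc => (hp c (List.mem_toFinset.2 hc)).2.1).trans (powWord_sublist fun j => ?_)
    refine (hylen j).imp_right fun hj => ?_
    rw [hsumN, ← Finset.sum_filter]
    have h1 : (∑ c ∈ π with c.2 = j, (B c : ℝ)) * (y j).length ≤
        (∑ s, (t s : ℝ) * V s j) * (y j).length := by
      rw [Finset.sum_mul]
      calc ∑ c ∈ π with c.2 = j, (B c : ℝ) * (y j).length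
          ≤ ∑ c ∈ π with c.2 = j, N * ∑ e, f c e * e.readsTarget := by
            refine Finset.sum_le_sum fun c hc => ?_
            obtain ⟨hc', rfl⟩ := Finset.mem_filter.1 hc
            exact (hp c hc').2.2.2.1
        _ = (∑ s, (N * τ s) * V s j) * (y j).length := by
            rw [← Finset.mul_sum, hf.target j]
            simp only [mul_assoc, ← Finset.mul_sum]
            ring
        _ ≤ (∑ s, (t s : ℝ) * V s j) * (y j).length := by
            refine mul_le_mul_of_nonneg_right (Finset.sum_le_sum fun s _ => ?_) hj.le
            exact mul_le_mul_of_nonneg_right (Nat.le_ceil _) (Nat.cast_nonneg _)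
    have h2 := le_of_mul_le_mul_right h1 hj
    have h3 : ∑ c ∈ π with c.2 = j, B c ≤ ∑ s, t s * V s j := by exact_mod_cast h2
    simp only [Pi.add_apply, Finset.sum_apply, Pi.smul_apply, smul_eq_mul]
    exact h3.trans (Nat.le_add_left _ _)
  -- The padding has bounded length, because the flow accounts for `ν` and for the target vector
  -- up to a constant.
  obtain ⟨q, hq, hqlen, hqw⟩ := exists_pad hsrc htgt
  refine ⟨t, q, hq, ?_⟩
  rw [length_powWord, length_powWord, powLength_add, powLength_add, powLength_sum] at hqlen hqw
  push_cast at hqlen hqw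
  have hweight : pathWeight P ≤ N * lpObjective x y π f := by
    rw [hP, pathWeight_flatMap, hsum, lpObjective, Finset.mul_sum]
    exact Finset.sum_le_sum fun c hc => (hp c hc).2.2.2.2.1
  have hlen : N ≤ P.length + ∑ c, K c := by
    have h1 : (P.length : ℝ) = ∑ c ∈ π, ((p c).length : ℝ) := by
      rw [hP, List.length_flatMap, hsumN, Nat.cast_sum]
    calc N = ∑ c ∈ π, N * ∑ e, f c e := by rw [← Finset.mul_sum, hf.normalization, mul_one]
      _ ≤ ∑ c ∈ π, ((p c).length + K c) :=
          Finset.sum_le_sum fun c hc => (hp c hc).2.2.2.2.2.1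
      _ ≤ _ := by rw [Finset.sum_add_distrib, h1]; linarith
  have hslen : (L : ℝ) ≤ (srcWord P).length + ∑ c, K c := by
    have h1 : ((srcWord P).length : ℝ) = ∑ c ∈ π, ((srcWord (p c)).length : ℝ) := by
      rw [hP, srcWord_flatMap, List.length_flatMap, hsumN, Nat.cast_sum]
    have h2 : ∑ c ∈ π, ∑ e, f c e * e.readsSource = lam := by
      rw [← sum_fiberwise_fst, Finset.sum_congr rfl fun i _ => hf.source i, ← Finset.sum_mul,
        sum_length_mul_direction hν, one_mul]
    calc (L : ℝ) = ∑ c ∈ π, N * ∑ e, f c e * e.readsSource := by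
          rw [← Finset.mul_sum, h2, hNlam]
      _ ≤ ∑ c ∈ π, ((srcWord (p c)).length + K c) :=
          Finset.sum_le_sum fun c hc => (hp c hc).2.2.2.2.2.2.1
      _ ≤ _ := by rw [Finset.sum_add_distrib, h1]; linarith
  have htlen : ∑ s, (t s : ℝ) * powLength y (V s) ≤
      (tgtWord P).length + ∑ c, K c + ∑ s, (powLength y (V s) : ℝ) := by
    have h1 : ((tgtWord P).length : ℝ) = ∑ c ∈ π, ((tgtWord (p c)).length : ℝ) := by
      rw [hP, tgtWord_flatMap, List.length_flatMap, hsumN, Nat.cast_sum]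
    have h2 : ∑ c ∈ π, ∑ e, f c e * e.readsTarget = ∑ s, τ s * (powLength y (V s) : ℝ) := by
      rw [← sum_fiberwise_snd, Finset.sum_congr rfl fun i _ => hf.target i, sum_length_mul_sum]
    have h3 : N * ∑ s, τ s * (powLength y (V s) : ℝ) ≤ (tgtWord P).length + ∑ c, K c := by
      calc N * ∑ s, τ s * (powLength y (V s) : ℝ)
          = ∑ c ∈ π, N * ∑ e, f c e * e.readsTarget := by rw [← Finset.mul_sum, h2]
        _ ≤ ∑ c ∈ π, ((tgtWord (p c)).length + K c) :=
            Finset.sum_le_sum fun c hc => (hp c hc).2.2.2.2.2.2.2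
        _ ≤ _ := by rw [Finset.sum_add_distrib, h1]; linarith
    calc ∑ s, (t s : ℝ) * powLength y (V s)
        ≤ ∑ s, (N * τ s + 1) * (powLength y (V s) : ℝ) :=
          Finset.sum_le_sum fun s _ => mul_le_mul_of_nonneg_right
            (Nat.ceil_lt_add_one (mul_nonneg hN0 (hf.tau_nonneg s))).le (Nat.cast_nonneg _)
      _ = N * ∑ s, τ s * (powLength y (V s) : ℝ) + ∑ s, (powLength y (V s) : ℝ) := by
          rw [Finset.mul_sum, ← Finset.sum_add_distrib]
          exact Finset.sum_congr rfl fun s _ => by ring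
      _ ≤ _ := by linarith
  have hsP : ((srcWord P).length : ℝ) ≤ powLength x u₀ + L := by
    have := hsrc.length_le
    rw [length_powWord, powLength_add] at this
    exact_mod_cast this
  have htP : ((tgtWord P).length : ℝ) ≤ powLength y v₀ + ∑ s, (t s : ℝ) * powLength y (V s) := by
    have := htgt.length_le
    rw [length_powWord, powLength_add, powLength_sum] at this
    exact_mod_cast this
  have h0 : (0 : ℝ) ≤ powLength x u₀ + powLength y v₀ + ∑ s, (powLength y (V s) : ℝ) := by
    positivity
  push_cast
  constructor <;> linarith

end FlowToPath

/-! ### From edit paths to flows -/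

section PathToFlow

variable {α : Type*} {n m : ℕ}

lemma sum_update_cons {ι : Type*} [Fintype ι] [DecidableEq ι] {β : ι → Type*}
    (l : ∀ i, List (β i)) (i : ι) (b : β i) (g : ∀ i, β i → ℝ) :
    ∑ j, ((Function.update l i (b :: l i) j).map (g j)).sum =
      g i b + ∑ j, ((l j).map (g j)).sum := by
  rw [← Finset.add_sum_erase _ _ (Finset.mem_univ i),
    ← Finset.add_sum_erase _ (fun j => ((l j).map (g j)).sum) (Finset.mem_univ i)]
  rw [Function.update_self, List.map_cons, List.sum_cons, add_assoc]
  congr 2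
  refine Finset.sum_congr rfl fun j hj => ?_
  rw [Function.update_of_ne (Finset.ne_of_mem_erase hj)]

lemma flatten_ofFn_eq_cons {a : α} {w : List α} {N : ℕ} {wx : Fin N → List α} {i : Fin N}
    (h : (List.ofFn wx).flatten = a :: w) (hlt : ∀ j < i, wx j = [])
    (hi : wx i = [] → i.val + 1 = N) :
    ∃ w', wx i = a :: w' ∧ w = (List.ofFn (Function.update wx i w')).flatten := by
  induction N with
  | zero => exact i.elim0
  | succ N ih =>
    rw [List.ofFn_succ, List.flatten_cons] at h
    revert hlt hi
    refine Fin.cases (fun _ hi => ?_) (fun i hlt hi => ?_) i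
    · cases h0 : wx 0 with
      | nil =>
        have hN : N = 0 := by simpa using (hi h0).symm
        subst hN
        simp [h0] at h
      | cons b w' =>
        rw [h0, List.cons_append, List.cons.injEq] at h
        refine ⟨w', by rw [h.1], ?_⟩
        rw [← h.2, List.ofFn_succ, List.flatten_cons, Function.update_self]
        simp
    · have h0 : wx 0 = [] := hlt 0 (Fin.succ_pos i)
      rw [h0, List.nil_append] at h
      obtain ⟨w', h1, h2⟩ := ih h (i := i) (fun j hj => hlt _ (Fin.succ_lt_succ_iff.2 hj))
        fun h => by simpa using hi h
      refine ⟨w', h1, ?_⟩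
      rw [h2, List.ofFn_succ, List.flatten_cons, Function.update_of_ne (Fin.succ_ne_zero i).symm, h0,
        List.nil_append]
      congr 2
      funext j
      simp [Function.update_apply]

lemma CycReads.update {N : ℕ} {z : Fin N → List α} {l : ∀ i, CycPos (z i)}
    {w : Fin N → List α} (h : ∀ i, CycReads (z i) (l i) (w i)) {i : Fin N} {l' : CycPos (z i)}
    {w' : List α} (hi : CycReads (z i) l' w') (j : Fin N) :
    CycReads (z j) (Function.update l i l' j) (Function.update w i w' j) := by
  rcases eq_or_ne j i with rfl | hne
  · simpa using hi
  · simpa [Function.update_of_ne hne] using h j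

lemma length_update_tail {N : ℕ} {w : Fin N → List α} {i : Fin N} {a : α} {w' : List α}
    (h : w i = a :: w') (j : Fin N) :
    ((w j).length : ℝ) = (if i = j then 1 else 0) + ((Function.update w i w' j).length : ℝ) := by
  rcases eq_or_ne j i with rfl | hne
  · simp [h, add_comm]
  · simp [Function.update_of_ne hne, hne.symm]

lemma update_eq_nil {N : ℕ} {w : Fin N → List α} {i : Fin N} {w' : List α}
    (h : ∀ j < i, w j = []) : ∀ j < i, Function.update w i w' j = [] := fun j hj => by
  rw [Function.update_of_ne hj.ne]; exact h j hj

variable [DecidableEq α]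

/-- A record of how an edit path `p` runs through the cyclic edit graphs: `L` lists the visited
cells, from `c` to the last cell of the grid, and `W d` is the walk that `p` performs in the cell
`d`, with `s` the initial vertex of the walk in `c`.  The path reads `a i` letters in the `i`-th
block of the source word and `b j` letters in the `j`-th block of the target word. -/
structure CellTrace (x : Fin n → List α) (y : Fin m → List α) (c : Fin n × Fin m)
    (s : CycVertex (x c.1) (y c.2)) (p : List (EditOp α)) (a : Fin n → ℕ) (b : Fin m → ℕ)
    (L : List (Fin n × Fin m)) (W : ∀ d : Fin n × Fin m, List (CycEdge (x d.1) (y d.2))) :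
    Prop where
  chain : L.IsChain GridStep
  head : L.head? = some c
  last : ∃ d ∈ L.getLast?, d.1.val + 1 = n ∧ d.2.val + 1 = m
  mem : ∀ d, W d ≠ [] → d ∈ L
  start : ∃ t, IsWalk CycEdge.src CycEdge.tgt s (W c) t
  walk : ∀ d, ∃ s t, IsWalk CycEdge.src CycEdge.tgt s (W d) t
  length : ∑ d, ((W d).map fun _ => (1 : ℝ)).sum = p.length
  weight : ∑ d, ((W d).map CycEdge.weight).sum = pathWeight p
  source : ∀ i, ∑ d, ((W d).map fun e => if d.1 = i then e.readsSource else 0).sum = a i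
  target : ∀ j, ∑ d, ((W d).map fun e => if d.2 = j then e.readsTarget else 0).sum = b j

variable {x : Fin n → List α} {y : Fin m → List α} {c : Fin n × Fin m}
  {L : List (Fin n × Fin m)} {W : ∀ d : Fin n × Fin m, List (CycEdge (x d.1) (y d.2))}
  {p : List (EditOp α)} {a : Fin n → ℕ} {b : Fin m → ℕ}

/-- Moving to the next cell. -/
lemma CellTrace.advance {c' : Fin n × Fin m} {s' : CycVertex (x c'.1) (y c'.2)}
    (h : CellTrace x y c' s' p a b L W) (hc : GridStep c c') (s : CycVertex (x c.1) (y c.2)) :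
    CellTrace x y c s p a b (c :: L) W := by
  have hch : (c :: L).IsChain GridStep := by
    have h1 := h.chain
    have h2 := h.head
    cases L with
    | nil => simp at h2
    | cons d L =>
      obtain rfl : d = c' := by simpa using h2
      exact List.isChain_cons_cons.2 ⟨hc, h1⟩
  have hcL : c ∉ L := fun hmem =>
    lt_irrefl c ((List.pairwise_cons.1 (pairwise_lt_of_isChain hch)).1 c hmem)
  refine ⟨hch, rfl, ?_, fun d hd => List.mem_cons_of_mem _ (h.mem d hd), ?_, h.walk, h.length,
    h.weight, h.source, h.target⟩
  · obtain ⟨d, hd, hd'⟩ := h.last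
    refine ⟨d, ?_, hd'⟩
    have h2 := h.head
    cases L with
    | nil => simp at h2
    | cons d L => rwa [List.getLast?_cons_cons]
  · have : W c = [] := by_contra fun hne => hcL (h.mem c hne)
    exact ⟨s, by rw [this]; exact rfl⟩

/-- Performing an edit operation inside the current cell. -/
lemma CellTrace.cons {a' : Fin n → ℕ} {b' : Fin m → ℕ} (e : CycEdge (x c.1) (y c.2))
    (h : CellTrace x y c e.tgt p a b L W)
    (ha : ∀ i, (a' i : ℝ) = (if c.1 = i then e.readsSource else 0) + a i)
    (hb : ∀ j, (b' j : ℝ) = (if c.2 = j then e.readsTarget else 0) + b j) :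
    CellTrace x y c e.src (e.op :: p) a' b' L (Function.update W c (e :: W c)) := by
  have hstart : ∃ t, IsWalk CycEdge.src CycEdge.tgt e.src
      (Function.update W c (e :: W c) c) t := by
    obtain ⟨t, ht⟩ := h.start
    rw [Function.update_self]
    exact ⟨t, rfl, ht⟩
  refine ⟨h.chain, h.head, h.last, fun d hd => ?_, hstart, fun d => ?_, ?_, ?_, fun i => ?_,
    fun j => ?_⟩
  · rcases eq_or_ne d c with rfl | hne
    · exact List.mem_of_mem_head? h.head
    · rw [Function.update_of_ne hne] at hd
      exact h.mem d hd
  · rcases eq_or_ne d c with rfl | hne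
    · exact ⟨_, hstart⟩
    · rw [Function.update_of_ne hne]
      exact h.walk d
  · rw [sum_update_cons W c e fun _ _ => (1 : ℝ), h.length, List.length_cons, Nat.cast_succ,
      add_comm]
  · rw [sum_update_cons W c e fun _ => CycEdge.weight, h.weight, pathWeight_cons,
      CycEdge.opWeight_op]
  · rw [sum_update_cons W c e fun d e => if d.1 = i then e.readsSource else 0, h.source, ha]
  · rw [sum_update_cons W c e fun d e => if d.2 = j then e.readsTarget else 0, h.target, hb]

/-- An edit path between concatenations of blocks that are read off cyclic words can be traced
through the cyclic edit graphs. -/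
theorem exists_cellTrace (x : Fin n → List α) (y : Fin m → List α) (k : ℕ) :
    ∀ (c : Fin n × Fin m) (p : List (EditOp α)) (wx : Fin n → List α) (wy : Fin m → List α)
      (l : ∀ i, CycPos (x i)) (l' : ∀ j, CycPos (y j)),
      p.length + (n - c.1) + (m - c.2) ≤ k →
      (∀ i, CycReads (x i) (l i) (wx i)) → (∀ j, CycReads (y j) (l' j) (wy j)) →
      (∀ i < c.1, wx i = []) → (∀ j < c.2, wy j = []) →
      srcWord p = (List.ofFn wx).flatten → tgtWord p = (List.ofFn wy).flatten →
      ∃ L W, CellTrace x y c (l c.1, l' c.2) p (fun i => (wx i).length)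
        (fun j => (wy j).length) L W := by
  induction k with
  | zero =>
    intro c p wx wy l l' hk
    have := c.1.2
    omega
  | succ k ih =>
    intro c p wx wy l l' hk hrx hry hx hy hpx hpy
    by_cases hcx : wx c.1 = [] ∧ c.1.val + 1 < n
    · have hnil : ∀ i, i.val < c.1.val + 1 → wx i = [] := fun i hi => by
        rcases (Nat.lt_succ_iff.1 hi).lt_or_eq with h | h
        · exact hx i h
        · rw [Fin.ext h]; exact hcx.1
      obtain ⟨L, W, h⟩ := ih (⟨c.1.val + 1, hcx.2⟩, c.2) p wx wy l l'
        (by dsimp only; omega) hrx hry hnil hy hpx hpy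
      exact ⟨_, W, h.advance (c := c) (Or.inl ⟨rfl, rfl⟩) _⟩
    by_cases hcy : wy c.2 = [] ∧ c.2.val + 1 < m
    · have hnil : ∀ j, j.val < c.2.val + 1 → wy j = [] := fun j hj => by
        rcases (Nat.lt_succ_iff.1 hj).lt_or_eq with h | h
        · exact hy j h
        · rw [Fin.ext h]; exact hcy.1
      obtain ⟨L, W, h⟩ := ih (c.1, ⟨c.2.val + 1, hcy.2⟩) p wx wy l l'
        (by dsimp only; omega) hrx hry hx hnil hpx hpy
      exact ⟨_, W, h.advance (c := c) (Or.inr ⟨rfl, rfl⟩) _⟩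
    have hcx' : wx c.1 = [] → c.1.val + 1 = n := fun h =>
      le_antisymm c.1.2 (not_lt.1 fun h' => hcx ⟨h, h'⟩)
    have hcy' : wy c.2 = [] → c.2.val + 1 = m := fun h =>
      le_antisymm c.2.2 (not_lt.1 fun h' => hcy ⟨h, h'⟩)
    rcases p with _ | ⟨⟨⟨o, o'⟩, ho⟩, p⟩
    · have hx0 : ∀ i, wx i = [] := by
        simpa [List.mem_ofFn, eq_comm (a := ([] : List α))] using hpx
      have hy0 : ∀ j, wy j = [] := by
        simpa [List.mem_ofFn, eq_comm (a := ([] : List α))] using hpy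
      exact ⟨[c], fun _ => [], by simp, rfl, ⟨c, rfl, hcx' (hx0 _), hcy' (hy0 _)⟩, by simp,
        ⟨_, rfl⟩, fun d => ⟨(l d.1, l' d.2), _, rfl⟩, by simp, by simp, by simp [hx0],
        by simp [hy0]⟩
    rw [List.length_cons] at hk
    rw [srcWord_cons] at hpx
    rw [tgtWord_cons] at hpy
    rcases o with _ | u <;> rcases o' with _ | v
    · exact absurd rfl ho
    · obtain ⟨w, hw, hpy'⟩ := flatten_ofFn_eq_cons hpy.symm hy hcy'
      have hr := hry c.2
      rw [hw] at hr
      obtain ⟨⟨hlt, rfl⟩, hr⟩ := hr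
      obtain ⟨L, W, h⟩ := ih c p wx (Function.update wy c.2 w) l (Function.update l' c.2 _)
        (by omega) hrx (CycReads.update hry hr) hx (update_eq_nil hy) hpx hpy'
      rw [Function.update_self] at h
      have h2 := CellTrace.cons (e := CycEdge.ins (l c.1) ⟨_, hlt⟩) h
        (a' := fun i => (wx i).length) (b' := fun j => (wy j).length)
        (by simp [CycEdge.readsSource]) (length_update_tail hw)
      rw [CycEdge.src, CycPos.mk_val] at h2
      exact ⟨_, _, h2⟩
    · obtain ⟨w, hw, hpx'⟩ := flatten_ofFn_eq_cons hpx.symm hx hcx'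
      have hr := hrx c.1
      rw [hw] at hr
      obtain ⟨⟨hlt, rfl⟩, hr⟩ := hr
      obtain ⟨L, W, h⟩ := ih c p (Function.update wx c.1 w) wy (Function.update l c.1 _) l'
        (by omega) (CycReads.update hrx hr) hry (update_eq_nil hx) hy hpx' hpy
      rw [Function.update_self] at h
      have h2 := CellTrace.cons (e := CycEdge.del ⟨_, hlt⟩ (l' c.2)) h
        (a' := fun i => (wx i).length) (b' := fun j => (wy j).length)
        (length_update_tail hw) (by simp [CycEdge.readsTarget])
      rw [CycEdge.src, CycPos.mk_val] at h2
      exact ⟨_, _, h2⟩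
    · obtain ⟨w, hw, hpx'⟩ := flatten_ofFn_eq_cons hpx.symm hx hcx'
      obtain ⟨w', hw', hpy'⟩ := flatten_ofFn_eq_cons hpy.symm hy hcy'
      have hr := hrx c.1
      rw [hw] at hr
      obtain ⟨⟨hlt, rfl⟩, hr⟩ := hr
      have hr' := hry c.2
      rw [hw'] at hr'
      obtain ⟨⟨hlt', rfl⟩, hr'⟩ := hr'
      obtain ⟨L, W, h⟩ := ih c p (Function.update wx c.1 w) (Function.update wy c.2 w')
        (Function.update l c.1 _) (Function.update l' c.2 _)
        (by omega) (CycReads.update hrx hr) (CycReads.update hry hr') (update_eq_nil hx)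
        (update_eq_nil hy) hpx' hpy'
      rw [Function.update_self, Function.update_self] at h
      have h2 := CellTrace.cons (e := CycEdge.diag ⟨_, hlt⟩ ⟨_, hlt'⟩) h
        (a' := fun i => (wx i).length) (b' := fun j => (wy j).length)
        (length_update_tail hw) (length_update_tail hw')
      rw [CycEdge.src, CycPos.mk_val, CycPos.mk_val] at h2
      exact ⟨_, _, h2⟩

open Classical in
lemma sum_count_mul {E : Type*} [Fintype E] (l : List E) (g : E → ℝ) :
    ∑ e, (l.count e : ℝ) * g e = (l.map g).sum := by
  induction l with
  | nil => simp
  | cons a l ih =>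
    simp [List.count_cons, add_mul, Finset.sum_add_distrib, ih, add_comm]

/-- The edge counts of an edit path form a flow along some interleaving; flow conservation can
fail only at the two ends of the walk in each cell. -/
theorem exists_flow_of_isEditPath (hn : 0 < n) (hm : 0 < m) (x : Fin n → List α)
    (y : Fin m → List α) {ν : Fin n → ℕ} {μ : Fin m → ℕ} {p : List (EditOp α)}
    (hp : IsEditPath p (powWord x ν) (powWord y μ)) :
    ∃ (π : Finset (Fin n × Fin m)) (f : FlowVar x y), IsInterleaving π ∧ (∀ c e, 0 ≤ f c e) ∧
      ∑ c ∈ π, ∑ e, f c e = p.length ∧ (∀ c e, f c e ≤ p.length) ∧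
      (∀ c, ∀ w : CycVertex (x c.1) (y c.2),
        |∑ e with CycEdge.src e = w, f c e - ∑ e with CycEdge.tgt e = w, f c e| ≤ 1) ∧
      (∀ i, ∑ c ∈ π with c.1 = i, ∑ e, f c e * e.readsSource = ν i * (x i).length) ∧
      (∀ j, ∑ c ∈ π with c.2 = j, ∑ e, f c e * e.readsTarget = μ j * (y j).length) ∧
      lpObjective x y π f = pathWeight p := by
  classical
  obtain ⟨L, W, h⟩ := exists_cellTrace x y _ (⟨0, hn⟩, ⟨0, hm⟩) p _ _
    (fun i => CycPos.mk (x i) 0) (fun j => CycPos.mk (y j) 0) le_rfl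
    (fun i => cycReads_replicate (ν i)) (fun j => cycReads_replicate (μ j))
    (fun i hi => absurd hi (Nat.not_lt_zero _)) (fun i hi => absurd hi (Nat.not_lt_zero _))
    hp.1 hp.2
  have hsum : ∀ g : ∀ d : Fin n × Fin m, CycEdge (x d.1) (y d.2) → ℝ,
      ∑ c ∈ L.toFinset, ∑ e, ((W c).count e : ℝ) * g c e = ∑ c, ((W c).map (g c)).sum := by
    intro g
    simp only [sum_count_mul]
    refine Finset.sum_subset (Finset.subset_univ _) fun c _ hc => ?_
    have : W c = [] := by_contra fun hne => hc (List.mem_toFinset.2 (h.mem c hne))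
    simp [this]
  have hone := hsum fun _ _ => 1
  simp only [mul_one, h.length] at hone
  refine ⟨L.toFinset, fun c e => (W c).count e, ⟨L, h.chain, ⟨_, h.head, rfl, rfl⟩, h.last, rfl⟩,
    fun c e => Nat.cast_nonneg _, hone, fun c e => ?_, fun c w => ?_, fun i => ?_, fun j => ?_, ?_⟩
  · by_cases hc : c ∈ L.toFinset
    · rw [← hone]
      exact (Finset.single_le_sum (f := fun e => ((W c).count e : ℝ))
        (fun e _ => Nat.cast_nonneg _) (Finset.mem_univ e)).trans
        (Finset.single_le_sum (f := fun c => ∑ e, ((W c).count e : ℝ))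
        (fun c _ => Finset.sum_nonneg fun e _ => Nat.cast_nonneg _) hc)
    · have : W c = [] := by_contra fun hne => hc (List.mem_toFinset.2 (h.mem c hne))
      simp [this]
  · obtain ⟨s, t, hw⟩ := h.walk c
    have h1 := hw.balance w
    have h2 := sum_count_mul (W c) fun e => if e.src = w then 1 else 0
    have h3 := sum_count_mul (W c) fun e => if e.tgt = w then 1 else 0
    simp only [mul_ite, mul_one, mul_zero, ← Finset.sum_filter] at h2 h3
    rw [h2, h3, abs_le]
    split_ifs at h1 <;> constructor <;> linarith
  · have h1 := (hsum fun d e => if d.1 = i then e.readsSource else 0).trans (h.source i)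
    rw [Finset.sum_filter]
    refine Eq.trans (Finset.sum_congr rfl fun c _ => ?_) (h1.trans ?_)
    · split_ifs <;> simp
    · simp
  · have h1 := (hsum fun d e => if d.2 = j then e.readsTarget else 0).trans (h.target j)
    rw [Finset.sum_filter]
    refine Eq.trans (Finset.sum_congr rfl fun c _ => ?_) (h1.trans ?_)
    · split_ifs <;> simp
    · simp
  · exact (hsum fun _ => CycEdge.weight).trans h.weight

end PathToFlow

/-! ### The linear program -/

section LinearProgram

variable {α : Type*} {n m r : ℕ}

lemma exists_mem_row {L : List (Fin n × Fin m)} (hL : L.IsChain GridStep) {c d : Fin n × Fin m}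
    (hc : c ∈ L.head?) (hd : d ∈ L.getLast?) {i : Fin n} (h₁ : c.1 ≤ i) (h₂ : i ≤ d.1) :
    ∃ j, (i, j) ∈ L := by
  induction L generalizing c with
  | nil => simp at hc
  | cons c' L ih =>
    obtain rfl : c' = c := by simpa using hc
    rcases eq_or_lt_of_le h₁ with rfl | hlt
    · exact ⟨c'.2, List.mem_cons_self⟩
    · cases L with
      | nil =>
        obtain rfl : c' = d := by simpa using hd
        exact absurd hlt (not_lt.2 h₂)
      | cons e L =>
        obtain ⟨hs, hL⟩ := List.isChain_cons_cons.1 hL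
        have he : e.1 ≤ i := by
          rw [Fin.lt_def] at hlt
          rcases hs with ⟨h, -⟩ | ⟨h, -⟩
          · exact Fin.le_def.2 (by omega)
          · rw [h]; exact h₁
        rw [List.getLast?_cons_cons] at hd
        obtain ⟨j, hj⟩ := ih hL rfl hd he
        exact ⟨j, List.mem_cons_of_mem _ hj⟩

lemma IsInterleaving.exists_mem_row {π : Finset (Fin n × Fin m)} (hπ : IsInterleaving π)
    (i : Fin n) : ∃ j, (i, j) ∈ π := by
  obtain ⟨L, hL, ⟨c, hc, hc', -⟩, ⟨d, hd, hd', -⟩, rfl⟩ := hπ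
  obtain ⟨j, hj⟩ := AHned.exists_mem_row hL hc hd (i := i) (Fin.le_def.2 (by omega))
    (Fin.le_def.2 (by omega))
  exact ⟨j, List.mem_toFinset.2 hj⟩

lemma directionSet_nonneg {x : Fin n → List α} {S : Set (Fin n → ℕ)} {a : Fin n → ℝ}
    (ha : a ∈ directionSet x S) (i : Fin n) : 0 ≤ a i := by
  have hcl : IsClosed {a : Fin n → ℝ | 0 ≤ a i} :=
    isClosed_le continuous_const (continuous_apply i)
  refine closure_minimal ?_ hcl ha
  rintro _ ⟨v, -, -, rfl⟩
  exact show (0 : ℝ) ≤ (v i : ℝ) / (powLength x v : ℝ) by positivity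

lemma sum_length_mul_of_mem_directionSet {x : Fin n → List α} {S : Set (Fin n → ℕ)}
    {a : Fin n → ℝ} (ha : a ∈ directionSet x S) : ∑ i, ((x i).length : ℝ) * a i = 1 := by
  have hcl : IsClosed {a : Fin n → ℝ | ∑ i, ((x i).length : ℝ) * a i = 1} :=
    isClosed_eq (by fun_prop) continuous_const
  refine closure_minimal ?_ hcl ha
  rintro _ ⟨v, -, hv, rfl⟩
  exact sum_length_mul_direction hv

/-- Deleting a whole period is a closed walk in the cyclic edit graph. -/
lemma exists_deletion_walk (u v : List α) : ∃ (C : List (CycEdge u v)) (s : CycVertex u v),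
    IsWalk CycEdge.src CycEdge.tgt s C s ∧ C.length = u.length ∧
    (C.map CycEdge.readsSource).sum = u.length ∧ (C.map CycEdge.readsTarget).sum = 0 := by
  have key : ∀ d l, l + d = u.length → ∃ C : List (CycEdge u v),
      IsWalk CycEdge.src CycEdge.tgt (CycPos.mk u l, CycPos.mk v 0) C
        (CycPos.mk u u.length, CycPos.mk v 0) ∧
      C.length = d ∧ (C.map CycEdge.readsSource).sum = d ∧
      (C.map CycEdge.readsTarget).sum = 0 := by
    intro d
    induction d with
    | zero => exact fun l hl => ⟨[], by rw [← hl]; exact rfl, rfl, by simp, by simp⟩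
    | succ d ih =>
      intro l hl
      obtain ⟨C, h1, h2, h3, h4⟩ := ih (l + 1) (by omega)
      refine ⟨.del ⟨l, by omega⟩ (CycPos.mk v 0) :: C, ⟨rfl, h1⟩, by simp [h2], ?_, ?_⟩
      · simp [CycEdge.readsSource, h3, add_comm]
      · simp [CycEdge.readsTarget, h4]
  obtain ⟨C, h1, h2, h3, h4⟩ := key u.length 0 (Nat.zero_add _)
  rw [CycPos.mk_length] at h1
  exact ⟨C, _, h1, h2, h3, h4⟩

/-- Periods that stand for the empty word do not contribute to the target constraint. -/
lemma length_mul_sum_mask {y : Fin m → List α} {V : Fin r → Fin m → ℕ} (τ : Fin r → ℝ) (j : Fin m) :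
    ((y j).length : ℝ) * ∑ s, (if powLength y (V s) = 0 then 0 else τ s) * (V s j : ℝ) =
      ((y j).length : ℝ) * ∑ s, τ s * (V s j : ℝ) := by
  rw [Finset.mul_sum, Finset.mul_sum]
  refine Finset.sum_congr rfl fun s _ => ?_
  split_ifs with h
  · have h1 : V s j * (y j).length = 0 := by
      rw [powLength, Finset.sum_eq_zero_iff] at h
      exact h j (Finset.mem_univ j)
    rcases Nat.mul_eq_zero.1 h1 with h1 | h1 <;> simp [h1]
  · rfl

/-- `τ s ≤ 1` as soon as the target part of the flow is at most `1` and the irrelevant variables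
`τ s` are set to `0`. -/
lemma mask_mem_Icc {y : Fin m → List α} {V : Fin r → Fin m → ℕ} {τ : Fin r → ℝ} (hτ : ∀ s, 0 ≤ τ s)
    (h : ∑ s, τ s * (powLength y (V s) : ℝ) ≤ 1) :
    (fun s => if powLength y (V s) = 0 then 0 else τ s) ∈ Set.Icc (0 : Fin r → ℝ) 1 := by
  refine ⟨fun s => ?_, fun s => ?_⟩ <;> dsimp only <;> split_ifs with h0
  · exact le_rfl
  · exact hτ s
  · exact zero_le_one
  · have h1 : τ s * (powLength y (V s) : ℝ) ≤ 1 := (Finset.single_le_sum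
      (f := fun s => τ s * (powLength y (V s) : ℝ))
      (fun s _ => mul_nonneg (hτ s) (Nat.cast_nonneg _)) (Finset.mem_univ s)).trans h
    have h2 : (1 : ℝ) ≤ powLength y (V s) := by exact_mod_cast Nat.one_le_iff_ne_zero.2 h0
    exact (le_mul_of_one_le_right (hτ s) h2).trans h1

variable [DecidableEq α]

lemma lpObjective_nonneg {x : Fin n → List α} {y : Fin m → List α} {π : Finset (Fin n × Fin m)}
    {f : FlowVar x y} (hf : ∀ c ∈ π, ∀ e, 0 ≤ f c e) : 0 ≤ lpObjective x y π f :=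
  Finset.sum_nonneg fun c hc => Finset.sum_nonneg fun e _ =>
    mul_nonneg (hf c hc e) e.weight_nonneg

lemma bddBelow_lpValues (x : Fin n → List α) (y : Fin m → List α) (V : Fin r → Fin m → ℕ)
    (a : Fin n → ℝ) (π : Finset (Fin n × Fin m)) : BddBelow (lpValues x y V a π) :=
  ⟨0, by rintro _ ⟨f, τ, lam, hf, rfl⟩; exact lpObjective_nonneg hf.flow_nonneg⟩

lemma lpOpt_nonneg (x : Fin n → List α) (y : Fin m → List α) (V : Fin r → Fin m → ℕ)
    (a : Fin n → ℝ) (π : Finset (Fin n × Fin m)) : 0 ≤ lpOpt x y V a π :=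
  Real.sInf_nonneg (by
    rintro _ ⟨f, τ, lam, hf, rfl⟩; exact lpObjective_nonneg hf.flow_nonneg)

variable {x : Fin n → List α} {y : Fin m → List α} {V : Fin r → Fin m → ℕ}
  {a : Fin n → ℝ} {π : Finset (Fin n × Fin m)}

open Classical in
/-- Deleting the whole source word is feasible. -/
lemma exists_lpFeasible (ha : ∀ i, 0 ≤ a i) (hsum : ∑ i, ((x i).length : ℝ) * a i = 1)
    (hπ : IsInterleaving π) :
    ∃ (f : FlowVar x y) (τ : Fin r → ℝ) (lam : ℝ), LPFeasible x y V a π f τ lam ∧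
      lpObjective x y π f ≤ 1 := by
  choose j hj using hπ.exists_mem_row
  choose C s hC hlen hsrc htgt using fun c : Fin n × Fin m =>
    exists_deletion_walk (x c.1) (y c.2)
  set f : FlowVar x y := fun c e => if c.2 = j c.1 then a c.1 * (C c).count e else 0 with hf
  have hf0 : ∀ c e, 0 ≤ f c e := fun c e => by
    rw [hf]; dsimp only
    split_ifs
    · exact mul_nonneg (ha _) (Nat.cast_nonneg _)
    · exact le_rfl
  have hfsum : ∀ c (g : CycEdge (x c.1) (y c.2) → ℝ), ∑ e, f c e * g e =
      if c.2 = j c.1 then a c.1 * ((C c).map g).sum else 0 := by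
    intro c g
    rw [hf]; dsimp only
    split_ifs
    · simp only [mul_assoc, ← Finset.mul_sum, sum_count_mul]
    · simp
  have hrow : ∀ i (g : Fin n × Fin m → ℝ),
      ∑ c ∈ π with c.1 = i, (if c.2 = j c.1 then g c else 0) = g (i, j i) := by
    intro i g
    rw [Finset.sum_eq_single_of_mem (i, j i) (by simp [hj])]
    · simp
    · rintro ⟨i', j'⟩ hc hne
      obtain ⟨-, rfl⟩ := Finset.mem_filter.1 hc
      exact if_neg fun h => hne (Prod.ext rfl h)
  have hnorm : ∑ c ∈ π, ∑ e, f c e = 1 := by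
    rw [← sum_fiberwise_fst, ← hsum]
    refine Finset.sum_congr rfl fun i _ => ?_
    have : ∀ c, ∑ e, f c e = if c.2 = j c.1 then a c.1 * (x c.1).length else 0 := by
      intro c
      have := hfsum c fun _ => 1
      simpa [hlen] using this
    rw [Finset.sum_congr rfl fun c _ => this c, hrow i fun c => a c.1 * (x c.1).length, mul_comm]
  refine ⟨f, 0, 1, ⟨fun c _ e => hf0 c e, fun s => le_rfl, by simp, hnorm, fun c _ w => ?_,
    fun i => ?_, fun j' => ?_⟩, ?_⟩
  · have h1 := hfsum c fun e => if e.src = w then 1 else 0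
    have h2 := hfsum c fun e => if e.tgt = w then 1 else 0
    simp only [mul_ite, mul_one, mul_zero, ← Finset.sum_filter] at h1 h2
    rw [h1, h2, add_right_cancel ((hC c).balance w)]
  · rw [Finset.sum_congr rfl fun c _ => hfsum c CycEdge.readsSource]
    rw [hrow i fun c => a c.1 * ((C c).map CycEdge.readsSource).sum, hsrc]
    ring
  · rw [Finset.sum_congr rfl fun c _ => hfsum c CycEdge.readsTarget]
    simp [htgt]
  · rw [← hnorm]
    exact Finset.sum_le_sum fun c _ => Finset.sum_le_sum fun e _ =>
      mul_le_of_le_one_right (hf0 c e) e.weight_le_one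

lemma lpOpt_le_one (ha : ∀ i, 0 ≤ a i) (hsum : ∑ i, ((x i).length : ℝ) * a i = 1)
    (hπ : IsInterleaving π) : lpOpt x y V a π ≤ 1 := by
  obtain ⟨f, τ, lam, h, h1⟩ := exists_lpFeasible (y := y) (V := V) ha hsum hπ
  exact (csInf_le (bddBelow_lpValues x y V a π) ⟨f, τ, lam, h, rfl⟩).trans h1

/-- The total violation of the equality constraints of the linear program. -/
def lpResidual (x : Fin n → List α) (y : Fin m → List α) (V : Fin r → Fin m → ℕ)
    (a : Fin n → ℝ) (π : Finset (Fin n × Fin m)) (f : FlowVar x y) (τ : Fin r → ℝ)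
    (lam : ℝ) : ℝ :=
  |∑ c ∈ π, ∑ e, f c e - 1| +
  ∑ c ∈ π, ∑ w : CycVertex (x c.1) (y c.2),
    |∑ e with CycEdge.src e = w, f c e - ∑ e with CycEdge.tgt e = w, f c e| +
  ∑ i, |∑ c ∈ π with c.1 = i, ∑ e, f c e * e.readsSource - ((x i).length : ℝ) * a i * lam| +
  ∑ j, |∑ c ∈ π with c.2 = j, ∑ e, f c e * e.readsTarget -
    ((y j).length : ℝ) * ∑ s, τ s * (V s j : ℝ)|

/-- A limit of approximately feasible points with objective value below `1` is feasible: since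
`λ` and the insertions account for the total flow, `λ` stays away from `0`. -/
lemma exists_lpFeasible_of_approx (hsum : ∑ i, ((x i).length : ℝ) * a i = 1) {z : ℝ} (hz : z < 1)
    (H : ∀ δ > 0, ∃ (f : FlowVar x y) (τ : Fin r → ℝ) (lam : ℝ), f ∈ Set.Icc 0 1 ∧
      τ ∈ Set.Icc 0 1 ∧ lam ∈ Set.Icc (0 : ℝ) 1 ∧ lpResidual x y V a π f τ lam ≤ δ ∧
      lpObjective x y π f ≤ z + δ) :
    ∃ (f : FlowVar x y) (τ : Fin r → ℝ) (lam : ℝ), LPFeasible x y V a π f τ lam ∧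
      lpObjective x y π f ≤ z := by
  have hcpt : IsCompact ((Set.Icc 0 1 : Set (FlowVar x y)) ×ˢ
      (Set.Icc 0 1 : Set (Fin r → ℝ)) ×ˢ Set.Icc (0 : ℝ) 1) :=
    isCompact_Icc.prod (isCompact_Icc.prod isCompact_Icc)
  -- `Φ` vanishes exactly at the points of the box with value at most `z` that satisfy all equality
  -- constraints, and its minimum over the box is attained.
  let Φ : FlowVar x y × (Fin r → ℝ) × ℝ → ℝ := fun q =>
    lpResidual x y V a π q.1 q.2.1 q.2.2 + max (lpObjective x y π q.1 - z) 0
  have hΦ : Continuous Φ := by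
    unfold Φ lpResidual lpObjective
    fun_prop
  obtain ⟨⟨f, τ, lam⟩, ⟨hf, hτ, hlam⟩, hmin⟩ := hcpt.exists_isMinOn
    ⟨(0, 0, 0), by simp⟩ hΦ.continuousOn
  have hle : Φ (f, τ, lam) ≤ 0 := by
    refine le_of_forall_pos_le_add fun δ hδ => ?_
    obtain ⟨f', τ', lam', hf', hτ', hlam', h1, h2⟩ := H (δ / 2) (half_pos hδ)
    refine (hmin (show (f', τ', lam') ∈ _ from ⟨hf', hτ', hlam'⟩)).trans ?_
    have h3 : max (lpObjective x y π f' - z) 0 ≤ δ / 2 := max_le (by linarith) (by linarith)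
    change lpResidual x y V a π f' τ' lam' + max (lpObjective x y π f' - z) 0 ≤ 0 + δ
    linarith
  dsimp only [Φ] at hle
  have hA : 0 ≤ |∑ c ∈ π, ∑ e, f c e - 1| := abs_nonneg _
  have hB : ∀ c ∈ π, 0 ≤ ∑ w : CycVertex (x c.1) (y c.2),
    |∑ e with CycEdge.src e = w, f c e - ∑ e with CycEdge.tgt e = w, f c e| :=
    fun c _ => Finset.sum_nonneg fun w _ => abs_nonneg _
  have hB' := Finset.sum_nonneg hB
  have hC : ∀ i ∈ Finset.univ, 0 ≤ |∑ c ∈ π with c.1 = i, ∑ e, f c e * e.readsSource -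
    ((x i).length : ℝ) * a i * lam| := fun i _ => abs_nonneg _
  have hC' := Finset.sum_nonneg hC
  have hD : ∀ j ∈ Finset.univ, 0 ≤ |∑ c ∈ π with c.2 = j, ∑ e, f c e * e.readsTarget -
    ((y j).length : ℝ) * ∑ s, τ s * (V s j : ℝ)| := fun i _ => abs_nonneg _
  have hD' := Finset.sum_nonneg hD
  have hE := le_max_right (lpObjective x y π f - z) 0
  have hF := le_max_left (lpObjective x y π f - z) 0
  rw [lpResidual] at hle
  have hobj : lpObjective x y π f ≤ z := by linarith
  have hnorm : ∑ c ∈ π, ∑ e, f c e = 1 :=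
    sub_eq_zero.1 (abs_eq_zero.1 (le_antisymm (by linarith) hA))
  have hcons := (Finset.sum_eq_zero_iff_of_nonneg hB).1 (le_antisymm (by linarith) hB')
  have hsrc : ∀ i, ∑ c ∈ π with c.1 = i, ∑ e, f c e * e.readsSource =
      ((x i).length : ℝ) * a i * lam := fun i =>
    sub_eq_zero.1 (abs_eq_zero.1 ((Finset.sum_eq_zero_iff_of_nonneg hC).1
      (le_antisymm (by linarith) hC') i (Finset.mem_univ i)))
  have htgt : ∀ j, ∑ c ∈ π with c.2 = j, ∑ e, f c e * e.readsTarget =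
      ((y j).length : ℝ) * ∑ s, τ s * (V s j : ℝ) := fun j =>
    sub_eq_zero.1 (abs_eq_zero.1 ((Finset.sum_eq_zero_iff_of_nonneg hD).1
      (le_antisymm (by linarith) hD') j (Finset.mem_univ j)))
  -- Every edge reads a source letter or has weight `1`, so `λ + cost ≥ 1`.
  have hlam0 : 0 < lam := by
    have h1 : ∑ c ∈ π, ∑ e, f c e * e.readsSource = lam := by
      rw [← sum_fiberwise_fst, Finset.sum_congr rfl fun i _ => hsrc i, ← Finset.sum_mul, hsum,
        one_mul]
    have h2 : 1 ≤ lam + lpObjective x y π f := by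
      rw [← hnorm, ← h1, lpObjective, ← Finset.sum_add_distrib]
      refine Finset.sum_le_sum fun c _ => ?_
      rw [← Finset.sum_add_distrib]
      refine Finset.sum_le_sum fun e _ => ?_
      have h3 : 1 ≤ e.readsSource + e.weight := by
        cases e <;> simp [CycEdge.readsSource, CycEdge.weight]
        split_ifs <;> norm_num
      rw [← mul_add]
      exact le_mul_of_one_le_right (hf.1 c e) h3
    linarith
  refine ⟨f, τ, lam, ⟨fun c _ e => hf.1 c e, hτ.1, ⟨hlam0, hlam.2⟩, hnorm, fun c hc w => ?_,
    hsrc, htgt⟩, hobj⟩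
  exact sub_eq_zero.1 (abs_eq_zero.1 ((Finset.sum_eq_zero_iff_of_nonneg
    fun w _ => abs_nonneg _).1 (hcons c hc) w (Finset.mem_univ w)))

/-- Every feasible point can be normalized to have all variables in `[0, 1]`. -/
lemma LPFeasible.exists_mem_Icc {f : FlowVar x y} {τ : Fin r → ℝ} {lam : ℝ}
    (h : LPFeasible x y V a π f τ lam) :
    ∃ (f' : FlowVar x y) (τ' : Fin r → ℝ), f' ∈ Set.Icc 0 1 ∧ τ' ∈ Set.Icc 0 1 ∧
      lpResidual x y V a π f' τ' lam = 0 ∧ lpObjective x y π f' = lpObjective x y π f := by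
  obtain ⟨g, hg, hg0⟩ : ∃ g : FlowVar x y, (∀ c ∈ π, g c = f c) ∧ ∀ c ∉ π, g c = 0 :=
    ⟨fun c => if c ∈ π then f c else 0, fun c hc => if_pos hc, fun c hc => if_neg hc⟩
  refine ⟨g, fun s => if powLength y (V s) = 0 then 0 else τ s,
    ⟨fun c e => ?_, fun c e => ?_⟩, mask_mem_Icc h.tau_nonneg ?_, ?_, ?_⟩
  · by_cases hc : c ∈ π
    · rw [hg c hc]; exact h.flow_nonneg c hc e
    · rw [hg0 c hc]; exact le_rfl
  · by_cases hc : c ∈ π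
    · rw [hg c hc, Pi.one_apply, Pi.one_apply, ← h.normalization]
      exact (Finset.single_le_sum (fun e _ => h.flow_nonneg c hc e) (Finset.mem_univ e)).trans
        (Finset.single_le_sum (f := fun c => ∑ e, f c e)
        (fun c hc => Finset.sum_nonneg fun e _ => h.flow_nonneg c hc e) hc)
    · rw [hg0 c hc]; exact zero_le_one
  · rw [← sum_length_mul_sum, ← Finset.sum_congr rfl fun j _ => h.target j, sum_fiberwise_snd,
      ← h.normalization]
    exact Finset.sum_le_sum fun c hc => Finset.sum_le_sum fun e _ =>
      mul_le_of_le_one_right (h.flow_nonneg c hc e) e.readsTarget_le_one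
  · have h1 : ∑ c ∈ π, ∑ e, g c e = 1 := by
      rw [← h.normalization]
      exact Finset.sum_congr rfl fun c hc => by rw [hg c hc]
    rw [lpResidual, h1, sub_self, abs_zero, zero_add, Finset.sum_eq_zero, Finset.sum_eq_zero,
      Finset.sum_eq_zero, add_zero, add_zero]
    · intro j _
      rw [length_mul_sum_mask, ← h.target j, abs_eq_zero, sub_eq_zero]
      exact Finset.sum_congr rfl fun c hc => by rw [hg c (Finset.mem_filter.1 hc).1]
    · intro i _
      rw [← h.source i, abs_eq_zero, sub_eq_zero]
      exact Finset.sum_congr rfl fun c hc => by rw [hg c (Finset.mem_filter.1 hc).1]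
    · refine fun c hc => Finset.sum_eq_zero fun w _ => ?_
      rw [hg c hc, h.conservation c hc w, sub_self, abs_zero]
  · exact Finset.sum_congr rfl fun c hc => by rw [hg c hc]

theorem isLeast_lpOpt (ha : ∀ i, 0 ≤ a i) (hsum : ∑ i, ((x i).length : ℝ) * a i = 1)
    (hπ : IsInterleaving π) : IsLeast (lpValues x y V a π) (lpOpt x y V a π) := by
  refine ⟨?_, fun z hz => csInf_le (bddBelow_lpValues x y V a π) hz⟩
  suffices H : ∃ (f : FlowVar x y) (τ : Fin r → ℝ) (lam : ℝ), LPFeasible x y V a π f τ lam ∧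
      lpObjective x y π f ≤ lpOpt x y V a π by
    obtain ⟨f, τ, lam, h, hle⟩ := H
    exact ⟨f, τ, lam, h,
      le_antisymm (csInf_le (bddBelow_lpValues x y V a π) ⟨f, τ, lam, h, rfl⟩) hle⟩
  obtain ⟨f, τ, lam, h, h1⟩ := exists_lpFeasible (y := y) (V := V) ha hsum hπ
  rcases le_or_gt 1 (lpOpt x y V a π) with h0 | h0
  · exact ⟨f, τ, lam, h, h1.trans h0⟩
  refine exists_lpFeasible_of_approx hsum h0 fun δ hδ => ?_
  obtain ⟨_, ⟨f', τ', lam', h', rfl⟩, hlt⟩ := exists_lt_of_csInf_lt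
    (show (lpValues x y V a π).Nonempty from ⟨_, f, τ, lam, h, rfl⟩)
    (show sInf (lpValues x y V a π) < lpOpt x y V a π + δ from lt_add_of_pos_right _ hδ)
  obtain ⟨f'', τ'', hf, hτ, hres, hobj⟩ := h'.exists_mem_Icc
  exact ⟨f'', τ'', lam', hf, hτ, ⟨h'.lam_mem.1.le, h'.lam_mem.2⟩, hres.le.trans hδ.le,
    hobj.le.trans hlt.le⟩

/-- Approximately feasible points have approximately optimal or larger objective values. -/
theorem exists_lpOpt_sub_le (ha : ∀ i, 0 ≤ a i) (hsum : ∑ i, ((x i).length : ℝ) * a i = 1)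
    (hπ : IsInterleaving π) {ε : ℝ} (hε : 0 < ε) :
    ∃ δ > 0, ∀ (f : FlowVar x y) (τ : Fin r → ℝ) (lam : ℝ), f ∈ Set.Icc 0 1 →
      τ ∈ Set.Icc 0 1 → lam ∈ Set.Icc (0 : ℝ) 1 → lpResidual x y V a π f τ lam ≤ δ →
      lpOpt x y V a π - ε ≤ lpObjective x y π f := by
  by_contra! H
  have h1 := lpOpt_le_one (y := y) (V := V) ha hsum hπ
  obtain ⟨f, τ, lam, h, hle⟩ := exists_lpFeasible_of_approx (V := V) (π := π) hsum
    (z := lpOpt x y V a π - ε) (by linarith) fun δ hδ => by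
      obtain ⟨f, τ, lam, hf, hτ, hlam, hres, hobj⟩ := H δ hδ
      exact ⟨f, τ, lam, hf, hτ, hlam, hres, by linarith⟩
  have h2 : lpOpt x y V a π ≤ lpObjective x y π f :=
    csInf_le (bddBelow_lpValues x y V a π) ⟨f, τ, lam, h, rfl⟩
  linarith

end LinearProgram

/-! ### The asymptotic distance -/

section Asymptotic

variable {α : Type*} {n m k r : ℕ}

lemma smul_mem_linearSet {U : Fin k → Fin n → ℕ} {v : Fin n → ℕ} (hv : v ∈ linearSet 0 U)
    (T : ℕ) : T • v ∈ linearSet 0 U := by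
  obtain ⟨t, rfl⟩ := hv
  exact ⟨T • t, by simp [Finset.smul_sum, mul_smul]⟩

lemma add_mem_linearSet {u₀ : Fin n → ℕ} {U : Fin k → Fin n → ℕ} {v : Fin n → ℕ}
    (hv : v ∈ linearSet 0 U) : u₀ + v ∈ linearSet u₀ U := by
  obtain ⟨t, rfl⟩ := hv
  exact ⟨t, by simp⟩

lemma direction_smul (x : Fin n → List α) (v : Fin n → ℕ) {T : ℕ} (hT : T ≠ 0) :
    direction x (T • v) = direction x v := by
  funext i
  rw [direction, direction, powLength_smul, Pi.smul_apply, smul_eq_mul, Nat.cast_mul, Nat.cast_mul]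
  exact mul_div_mul_left _ _ (Nat.cast_ne_zero.2 hT)

variable [DecidableEq α]

lemma nonempty_interleaving (hn : 0 < n) (hm : 0 < m) : Nonempty (Interleaving n m) := by
  obtain ⟨π, -, hπ, -⟩ := exists_flow_of_isEditPath (α := Bool) hn hm (fun _ => [])
    (fun _ => []) (ν := 0) (μ := 0) (p := []) (by simp [IsEditPath, powWord])
  exact ⟨⟨π, hπ⟩⟩

/-- The normalized edge counts of an edit path nearly satisfy the linear program for a direction
that is close to the direction of the source word. -/
theorem exists_lpResidual_le (hn : 0 < n) (hm : 0 < m) (x : Fin n → List α)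
    (y : Fin m → List α) (u₀ : Fin n → ℕ) (v₀ : Fin m → ℕ) (V : Fin r → Fin m → ℕ) :
    ∃ K : ℝ, ∀ (a : Fin n → ℝ) (ν : Fin n → ℕ) (t : Fin r → ℕ) (p : List (EditOp α)),
      powLength x ν ≠ 0 →
      IsEditPath p (powWord x (u₀ + ν)) (powWord y (v₀ + ∑ s, t s • V s)) →
      ∃ (π : Interleaving n m) (f : FlowVar x y) (τ : Fin r → ℝ) (lam : ℝ),
        f ∈ Set.Icc 0 1 ∧ τ ∈ Set.Icc 0 1 ∧ lam ∈ Set.Icc (0 : ℝ) 1 ∧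
        lpResidual x y V a π.1 f τ lam ≤
          K / p.length + ∑ i, ((x i).length : ℝ) * |direction x ν i - a i| ∧
        lpObjective x y π.1 f = pathCost p := by
  refine ⟨∑ c : Fin n × Fin m, ∑ _w : CycVertex (x c.1) (y c.2), (1 : ℝ) + powLength x u₀ +
    powLength y v₀, fun a ν t p hν hp => ?_⟩
  obtain ⟨π, f, hπ, hf0, hfsum, hf1, hcons, hsrc, htgt, hobj⟩ :=
    exists_flow_of_isEditPath hn hm x y hp
  have hpx : powLength x u₀ + powLength x ν ≤ p.length := by
    rw [← powLength_add, ← length_powWord, ← hp.1]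
    exact length_srcWord_le p
  have hpy : powLength y v₀ + ∑ s, t s * powLength y (V s) ≤ p.length := by
    rw [← powLength_sum, ← powLength_add, ← length_powWord, ← hp.2]
    exact length_tgtWord_le p
  set N : ℝ := (p.length : ℝ) with hN
  set l : ℝ := (powLength x ν : ℝ) with hl
  have hl0 : 0 < l := by
    rw [hl]; exact_mod_cast Nat.pos_of_ne_zero hν
  have hlN : l ≤ N := by
    rw [hl, hN]; exact_mod_cast (Nat.le_add_left _ _).trans hpx
  have hN0 : 0 < N := hl0.trans_le hlN
  have hlN1 : l / N ≤ 1 := div_le_one_of_le₀ hlN hN0.le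
  have hdiv : ∀ (c : Fin n × Fin m) (g : CycEdge (x c.1) (y c.2) → ℝ),
      ∑ e, f c e / N * g e = (∑ e, f c e * g e) / N := fun c g => by
    rw [Finset.sum_div]
    exact Finset.sum_congr rfl fun e _ => by ring
  refine ⟨⟨π, hπ⟩, fun c e => f c e / N,
    fun s => if powLength y (V s) = 0 then 0 else (t s : ℝ) / N, l / N,
    ⟨fun c e => div_nonneg (hf0 c e) hN0.le, fun c e => div_le_one_of_le₀ (hf1 c e) hN0.le⟩,
    mask_mem_Icc (fun s => by positivity) ?_, ⟨by positivity, hlN1⟩, ?_, ?_⟩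
  · have h1 : ∑ s, (t s : ℝ) * powLength y (V s) ≤ N := by
      rw [hN]; exact_mod_cast (Nat.le_add_left _ _).trans hpy
    calc ∑ s, (t s : ℝ) / N * powLength y (V s) = (∑ s, (t s : ℝ) * powLength y (V s)) / N := by
          rw [Finset.sum_div]
          exact Finset.sum_congr rfl fun s _ => by ring
      _ ≤ 1 := div_le_one_of_le₀ h1 hN0.le
  · have hA : |∑ c ∈ π, ∑ e, f c e / N - 1| = 0 := by
      simp only [← Finset.sum_div]
      rw [hfsum, div_self hN0.ne', sub_self, abs_zero]
    have hB : ∑ c ∈ π, ∑ w : CycVertex (x c.1) (y c.2),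
        |∑ e with CycEdge.src e = w, f c e / N - ∑ e with CycEdge.tgt e = w, f c e / N| ≤
        (∑ c : Fin n × Fin m, ∑ _w : CycVertex (x c.1) (y c.2), (1 : ℝ)) / N := by
      rw [Finset.sum_div]
      refine (Finset.sum_le_sum fun c _ => ?_).trans (Finset.sum_le_sum_of_subset_of_nonneg
        (Finset.subset_univ π) fun c _ _ => by positivity)
      rw [Finset.sum_div]
      refine Finset.sum_le_sum fun w _ => ?_
      rw [← Finset.sum_div, ← Finset.sum_div, ← sub_div, abs_div, abs_of_pos hN0]
      exact div_le_div_of_nonneg_right (hcons c w) hN0.le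
    have hC : ∑ i, |∑ c ∈ π with c.1 = i, ∑ e, f c e / N * e.readsSource -
        ((x i).length : ℝ) * a i * (l / N)| ≤
        powLength x u₀ / N + ∑ i, ((x i).length : ℝ) * |direction x ν i - a i| := by
      rw [powLength, Nat.cast_sum, Finset.sum_div, ← Finset.sum_add_distrib]
      refine Finset.sum_le_sum fun i _ => ?_
      simp only [hdiv]
      rw [← Finset.sum_div, hsrc i, Pi.add_apply]
      have h1 : (((u₀ i + ν i : ℕ) : ℝ) * (x i).length) / N - ((x i).length : ℝ) * a i * (l / N) =
          ((u₀ i * (x i).length : ℕ) : ℝ) / N +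
            ((x i).length : ℝ) * (direction x ν i - a i) * (l / N) := by
        rw [direction, ← hl]
        push_cast
        field_simp
        ring
      rw [h1]
      refine (abs_add_le _ _).trans (add_le_add (abs_of_nonneg (by positivity)).le ?_)
      rw [abs_mul, abs_mul, abs_of_nonneg (Nat.cast_nonneg _), abs_of_nonneg (div_pos hl0 hN0).le]
      exact mul_le_of_le_one_right (by positivity) hlN1
    have hD : ∑ j, |∑ c ∈ π with c.2 = j, ∑ e, f c e / N * e.readsTarget -
        ((y j).length : ℝ) * ∑ s, (if powLength y (V s) = 0 then 0 else (t s : ℝ) / N) *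
          (V s j : ℝ)| ≤ powLength y v₀ / N := by
      rw [powLength, Nat.cast_sum, Finset.sum_div]
      refine Finset.sum_le_sum fun j _ => ?_
      simp only [hdiv]
      rw [← Finset.sum_div, htgt j, length_mul_sum_mask, Pi.add_apply, Finset.sum_apply]
      have h1 : ((v₀ j + ∑ s, (t s • V s) j : ℕ) : ℝ) * (y j).length / N -
          ((y j).length : ℝ) * ∑ s, (t s : ℝ) / N * (V s j : ℝ) =
          ((v₀ j * (y j).length : ℕ) : ℝ) / N := by
        have h2 : ∑ s, (t s : ℝ) / N * (V s j : ℝ) = (∑ s, (t s : ℝ) * (V s j : ℝ)) / N := by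
          rw [Finset.sum_div]
          exact Finset.sum_congr rfl fun s _ => by ring
        rw [h2]
        simp only [Pi.smul_apply, smul_eq_mul]
        push_cast
        ring
      rw [h1, abs_of_nonneg (by positivity)]
    rw [lpResidual, hA, add_div, add_div]
    linarith
  · simp only [lpObjective, hdiv]
    rw [← Finset.sum_div, pathCost, ← hobj, lpObjective]

/-- The distance from a word to a language lies in `[0, 1]`. -/
lemma iInf_ned_mem_Icc (u : List α) (Y : Set (List α)) :
    (⨅ v : Y, ned u v.1) ∈ Set.Icc (0 : ℝ) 1 := by
  refine ⟨Real.iInf_nonneg fun v => ned_nonneg _ _, ?_⟩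
  rcases isEmpty_or_nonempty Y with h | ⟨⟨v⟩⟩
  · simp
  · exact (ciInf_le ⟨0, by rintro _ ⟨v, rfl⟩; exact ned_nonneg _ _⟩ v).trans (ned_le_one _ _)

lemma le_tailSup {X Y : Set (List α)} {u : List α} (hu : u ∈ X) {K : ℕ} (hK : K ≤ u.length) :
    (⨅ v : Y, ned u v.1) ≤ tailSup ned (fun w : List α => (w.length : ℝ)) X Y K :=
  le_ciSup (f := fun z : {z : List α // z ∈ X ∧ (K : ℝ) ≤ z.length} => ⨅ v : Y, ned z.1 v.1)
    ⟨1, by rintro _ ⟨z, rfl⟩; exact (iInf_ned_mem_Icc z.1 Y).2⟩ ⟨u, hu, by exact_mod_cast hK⟩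

lemma tailSup_nonneg (X Y : Set (List α)) (K : ℕ) :
    0 ≤ tailSup ned (fun w : List α => (w.length : ℝ)) X Y K :=
  Real.iSup_nonneg fun z => (iInf_ned_mem_Icc z.1 Y).1

lemma antitone_tailSup (X Y : Set (List α)) :
    Antitone (tailSup ned (fun w : List α => (w.length : ℝ)) X Y) := fun K _ h =>
  Real.iSup_le (fun z => le_tailSup z.2.1 (h.trans (Nat.cast_le.1 z.2.2)))
    (tailSup_nonneg X Y K)

lemma tendsto_tailSup (X Y : Set (List α)) :
    Tendsto (tailSup ned (fun w : List α => (w.length : ℝ)) X Y) atTop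
      (𝓝 (⨅ K, tailSup ned (fun w : List α => (w.length : ℝ)) X Y K)) :=
  tendsto_atTop_ciInf (antitone_tailSup X Y)
    ⟨0, by rintro _ ⟨K, rfl⟩; exact tailSup_nonneg X Y K⟩

variable {x : Fin n → List α} {y : Fin m → List α} {u₀ : Fin n → ℕ} {U : Fin k → Fin n → ℕ}
  {v₀ : Fin m → ℕ} {V : Fin r → Fin m → ℕ} {X Y : Set (List α)}

lemma iInf_lpOpt_le_one (hn : 0 < n) (hm : 0 < m) {a : Fin n → ℝ}
    (ha : a ∈ directionSet x (linearSet 0 U)) :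
    ⨅ π : Interleaving n m, lpOpt x y V a π.1 ≤ 1 := by
  obtain ⟨π⟩ := nonempty_interleaving hn hm
  exact (ciInf_le (Set.finite_range _).bddBelow π).trans
    (lpOpt_le_one (directionSet_nonneg ha) (sum_length_mul_of_mem_directionSet ha) π.2)

/-- Long words of the source language are realized by an optimal solution for their own
direction. -/
theorem iInf_tailSup_le (hn : 0 < n) (hm : 0 < m) (hX : X = powWord x '' linearSet u₀ U)
    (hY : Y = powWord y '' linearSet v₀ V) :
    ⨅ K, tailSup ned (fun w : List α => (w.length : ℝ)) X Y K ≤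
      ⨆ a : directionSet x (linearSet 0 U), ⨅ π : Interleaving n m, lpOpt x y V a.1 π.1 := by
  have := nonempty_interleaving hn hm
  refine le_of_forall_pos_le_add fun ε hε => ?_
  set S := ⨆ a : directionSet x (linearSet 0 U), ⨅ π : Interleaving n m, lpOpt x y V a.1 π.1
    with hS
  have hS0 : 0 ≤ S := Real.iSup_nonneg fun a => Real.iInf_nonneg fun π => lpOpt_nonneg _ _ _ _ _
  obtain ⟨K, hK0, hK⟩ := exists_path_of_lpFeasible x y u₀ v₀ V
  -- For `N ≥ ℓ(ν) ≥ k₀` the cost `(N * opt + K) / (N - K)` is at most `opt + ε`.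
  obtain ⟨k₀, hk₀⟩ := exists_nat_ge (K * (2 + ε) / ε + 1)
  refine (ciInf_le ⟨0, by rintro _ ⟨K, rfl⟩; exact tailSup_nonneg X Y K⟩
    (powLength x u₀ + k₀)).trans (Real.iSup_le ?_ (by positivity))
  rintro ⟨w, hw, hwlen⟩
  rw [hX] at hw
  obtain ⟨_, ⟨t, rfl⟩, rfl⟩ := hw
  set ν := ∑ q, t q • U q with hν
  have hνmem : ν ∈ linearSet 0 U := ⟨t, by simp [hν]⟩
  have hk₀' : k₀ ≤ powLength x ν := by
    have : powLength x u₀ + k₀ ≤ (powWord x (u₀ + ν)).length := Nat.cast_le.1 hwlen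
    rw [length_powWord, powLength_add] at this
    omega
  set l : ℝ := (powLength x ν : ℝ) with hl
  have hl1 : K * (2 + ε) / ε + 1 ≤ l := hk₀.trans (by rw [hl]; exact_mod_cast hk₀')
  have hKε : 0 ≤ K * (2 + ε) / ε := by positivity
  have hν0 : powLength x ν ≠ 0 := fun h => by rw [hl, h, Nat.cast_zero] at hl1; linarith
  have ha : direction x ν ∈ directionSet x (linearSet 0 U) :=
    subset_closure ⟨ν, hνmem, hν0, rfl⟩
  have ha0 := directionSet_nonneg ha
  have ha1 := sum_length_mul_of_mem_directionSet ha
  obtain ⟨π, hπ⟩ := exists_eq_ciInf_of_finite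
    (f := fun π : Interleaving n m => lpOpt x y V (direction x ν) π.1)
  have hle : lpOpt x y V (direction x ν) π.1 ≤ S := by
    refine hπ.le.trans (le_ciSup (f := fun a : directionSet x (linearSet 0 U) =>
      ⨅ π : Interleaving n m, lpOpt x y V a.1 π.1) ⟨1, ?_⟩ ⟨_, ha⟩)
    rintro _ ⟨a, rfl⟩
    exact iInf_lpOpt_le_one hn hm a.2
  have hone : lpOpt x y V (direction x ν) π.1 ≤ 1 := lpOpt_le_one ha0 ha1 π.2
  obtain ⟨f, τ, lam, hf, hopt⟩ := (isLeast_lpOpt (V := V) (y := y) ha0 ha1 π.2).1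
  obtain ⟨s, p, hp, hpw, hpl⟩ := hK π.1 f τ lam ν π.2 hν0 hf
  rw [← hopt, ← hl] at hpw
  rw [← hl] at hpl
  set N := l / lam with hN
  set o := lpOpt x y V (direction x ν) π.1
  have hNl : l ≤ N := le_div_self (by rw [hl]; positivity) hf.lam_mem.1 hf.lam_mem.2
  have hNε : K * (2 + ε) ≤ ε * N := by
    have h1 : K * (2 + ε) / ε ≤ N := by linarith
    rw [div_le_iff₀ hε] at h1
    linarith
  have hNK : K < N := by
    have h1 : K ≤ K * (2 + ε) / ε := by
      rw [le_div_iff₀ hε]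
      exact mul_le_mul_of_nonneg_left (by linarith) hK0
    linarith
  have hcost : pathCost p ≤ S + ε := by
    have hlen : (0 : ℝ) < p.length := by linarith
    refine le_trans ?_ (add_le_add_left hle ε)
    rw [pathCost, div_le_iff₀ hlen]
    have h1 : (o + ε) * (N - K) ≤ (o + ε) * p.length :=
      mul_le_mul_of_nonneg_left (by linarith) (add_nonneg (lpOpt_nonneg _ _ _ _ _) hε.le)
    have h2 : o * K ≤ 1 * K := mul_le_mul_of_nonneg_right hone hK0
    linarith
  refine le_trans ?_ hcost
  refine le_trans (ciInf_le ⟨0, by rintro _ ⟨v, rfl⟩; exact ned_nonneg _ _⟩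
    (⟨powWord y (v₀ + ∑ q, s q • V q), ?_⟩ : Y)) (ned_le_pathCost hp)
  rw [hY]
  exact ⟨_, ⟨s, rfl⟩, rfl⟩

/-- Every direction is approached by arbitrarily long words of the source language, whose edit
paths yield approximately feasible points. -/
theorem le_iInf_tailSup (hn : 0 < n) (hm : 0 < m) (hX : X = powWord x '' linearSet u₀ U)
    (hY : Y = powWord y '' linearSet v₀ V) :
    (⨆ a : directionSet x (linearSet 0 U), ⨅ π : Interleaving n m, lpOpt x y V a.1 π.1) ≤
      ⨅ K, tailSup ned (fun w : List α => (w.length : ℝ)) X Y K := by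
  have := nonempty_interleaving hn hm
  refine Real.iSup_le (fun a => le_ciInf fun k₀ => le_of_forall_pos_le_add fun ε hε => ?_)
    (Real.iInf_nonneg fun K => tailSup_nonneg X Y K)
  obtain ⟨a, ha⟩ := a
  have ha0 := directionSet_nonneg ha
  have ha1 := sum_length_mul_of_mem_directionSet ha
  choose δ' hδ' hstab using fun π : Interleaving n m =>
    exists_lpOpt_sub_le (y := y) (V := V) ha0 ha1 π.2 hε
  obtain ⟨π₀, hπ₀⟩ := Finite.exists_min δ'
  set δ := δ' π₀ with hδdef
  have hδ : 0 < δ := hδ' π₀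
  obtain ⟨K, hK⟩ := exists_lpResidual_le hn hm x y u₀ v₀ V
  obtain ⟨d, hd, v, hv, hv0, rfl⟩ : ∃ d : Fin n → ℝ,
      ∑ i, ((x i).length : ℝ) * |d i - a i| < δ / 2 ∧
      ∃ v ∈ linearSet 0 U, powLength x v ≠ 0 ∧ d = direction x v := by
    have hopen : IsOpen {d : Fin n → ℝ | ∑ i, ((x i).length : ℝ) * |d i - a i| < δ / 2} :=
      isOpen_lt (by fun_prop) continuous_const
    have h0 : ∑ i, ((x i).length : ℝ) * |a i - a i| < δ / 2 := by simpa using hδ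
    exact mem_closure_iff.1 ha _ hopen h0
  -- Multiples of `v` have the direction of `v`, and a large multiple makes the error `K / length`
  -- small.
  obtain ⟨T₀, hT₀⟩ := exists_nat_ge (2 * K / δ)
  set T := T₀ + k₀ + 1 with hT
  set ν := T • v with hν
  have hνlen : T ≤ powLength x ν := by
    rw [hν, powLength_smul]
    exact Nat.le_mul_of_pos_right _ (Nat.pos_of_ne_zero hv0)
  have hmem : powWord x (u₀ + ν) ∈ X := by
    rw [hX]
    exact ⟨_, add_mem_linearSet (smul_mem_linearSet hv T), rfl⟩
  have hlen : T ≤ (powWord x (u₀ + ν)).length := by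
    rw [length_powWord, powLength_add]
    omega
  rw [← sub_le_iff_le_add]
  refine le_trans ?_ (le_tailSup hmem (by omega))
  have : Nonempty Y := ⟨⟨powWord y v₀, by
    rw [hY]; exact ⟨_, ⟨0, by simp⟩, rfl⟩⟩⟩
  refine le_ciInf ?_
  rintro ⟨z, hz⟩
  rw [hY] at hz
  obtain ⟨_, ⟨t, rfl⟩, rfl⟩ := hz
  obtain ⟨p₀, hp₀⟩ := exists_isEditPath (powWord x (u₀ + ν)) (powWord y (v₀ + ∑ s, t s • V s))
  refine le_csInf ⟨_, p₀, hp₀, rfl⟩ ?_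
  rintro _ ⟨p, hp, rfl⟩
  obtain ⟨π, f, τ, lam, hf, hτ, hlam, hres, hobj⟩ := hK a ν t p (by omega) hp
  have hplen : T ≤ p.length := by
    refine hlen.trans ?_
    rw [← hp.1]
    exact length_srcWord_le p
  have hpK : K / p.length ≤ δ / 2 := by
    have h1 : (T₀ : ℝ) ≤ p.length := by exact_mod_cast (by omega : T₀ ≤ p.length)
    have h2 : (0 : ℝ) < p.length := by exact_mod_cast (by omega : 0 < p.length)
    have h3 := hT₀.trans h1
    rw [div_le_iff₀ hδ] at h3
    rw [div_le_iff₀ h2]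
    linarith
  rw [hν, direction_smul x v (by omega)] at hres
  have h1 := hstab π f τ lam hf hτ hlam (by linarith [hπ₀ π])
  have h2 : ⨅ π : Interleaving n m, lpOpt x y V a π.1 ≤ lpOpt x y V a π.1 :=
    ciInf_le (Set.finite_range _).bddBelow π
  linarith

end Asymptotic

end AHned

end

theorem mainTheorem11 {α : Type*} [Finite α] [DecidableEq α] {n m k r : ℕ}
    (hn : 0 < n) (hm : 0 < m)
    (x : Fin n → List α) (y : Fin m → List α)
    (u₀ : Fin n → ℕ) (U : Fin k → Fin n → ℕ) (v₀ : Fin m → ℕ) (V : Fin r → Fin m → ℕ)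
    (X Y : Language α)
    (hX : AHned.IsStratifiedLinearBCFL x u₀ U X)
    (hY : AHned.IsStratifiedLinearBCFL y v₀ V Y) :
    (∀ a ∈ AHned.directionSet x (AHned.linearSet 0 U), ∀ π : AHned.Interleaving n m,
      IsLeast (AHned.lpValues x y V a π.1) (AHned.lpOpt x y V a π.1)) ∧
    Tendsto (AHned.tailSup AHned.ned (fun w : List α => (w.length : ℝ)) X Y) atTop
      (𝓝 (AHned.asympNed X Y)) ∧
    AHned.asympNed X Y =
      ⨆ a : AHned.directionSet x (AHned.linearSet 0 U),
        ⨅ π : AHned.Interleaving n m, AHned.lpOpt x y V a.1 π.1 := by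
  have hlim := AHned.tendsto_tailSup (X : Set (List α)) (Y : Set (List α))
  have heq : AHned.asympNed X Y =
      ⨅ K, AHned.tailSup AHned.ned (fun w : List α => (w.length : ℝ)) X Y K := hlim.limUnder_eq
  refine ⟨fun a ha π => AHned.isLeast_lpOpt (AHned.directionSet_nonneg ha)
    (AHned.sum_length_mul_of_mem_directionSet ha) π.2, by rw [heq]; exact hlim, ?_⟩
  rw [heq]
  exact le_antisymm (AHned.iInf_tailSup_le hn hm hX.parikh hY.parikh)
    (AHned.le_iInf_tailSup hn hm hX.parikh hY.parikh)
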